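/- **Setting.** Let $1\le r\le k\le d$ and $m\ge 0$ be integers, and let $X_\natural\in\mathbb R^{d\times d}$ be a fixed positive semidefinite matrix of rank $r$ with singular values $\sigma_1\ge\dots\ge\sigma_r>0$ and condition number $\kappa=\sigma_1/\sigma_r$. Let $A_1,\dots,A_m\in\mathbb R^{d\times d}$ be i.i.d. from the Gaussian orthogonal ensemble (symmetric, with independent entries on and above the diagonal, $N(0,1)$ on the diagonal and $N(0,\tfrac12)$ above it), and observe $y_i=\langle A_i,X_\natural\rangle+s_i$, $i=1,\dots,m$, where the corruption $s=(s_1,\dots,s_m)$ follows one of two models. * *Arbitrary corruption (AC) with rate $p\ge0$*: the index set of the nonzero entries of $s$ is uniformly distributed over the subsets of $\{1,\dots,m\}$ of size $\lfloor pm\rfloor$ and independent of $(A_i)$; the values of the nonzero entries are arbitrary (they may depend on everything else). * *Random corruption (RC) with rate $p\in(0,1)$*: $s_1,\dots,s_m$ are random variables, independent of each other and of $(A_i)$, each with $\mathbb P(s_i\ne0)=p$. For $\epsilon\in(0,1)$ let $\theta_\epsilon$ be the $\epsilon$-quantile of $|Z|$, $Z\sim N(0,1)$, i.e. $\mathbb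 P(|Z|\le\theta_\epsilon)=\epsilon$. *Spectral initialization.* Put $D=\frac1m\sum_{i=1}^m\operatorname{sign}(y_i)A_i$ with $\operatorname{sign}(x)=1$ for $x\ge0$ and $-1$ for $x<0$. Let $\Sigma\in\mathbb R^{k\times k}$ be the diagonal matrix of the $k$ largest eigenvalues of $D$ (with multiplicity), $U\in\mathbb R^{d\times k}$ a matrix of corresponding orthonormal eigenvectors, and $B=U(\Sigma_+)^{1/2}$, where $\Sigma_+$ is the nonnegative part of $\Sigma$. Let $\xi$ be a median of $|y_1|,\dots,|y_m|$ and $\gamma=\xi/(\sqrt{2/\pi}\,\theta_{1/2})$. The output is $F_0=\sqrt\gamma\,B\in\mathbb R^{d\times k}$. The statements below hold simultaneously for all admissible choices of eigenvectors and median. $\|\cdot\|$ is the operator norm. **Proposition.** Fix $c_0\in(0,0.1)$. 1. (AC) There are constants $\tilde c_0,c_1,c_2,c_3>0$ depending only on $c_0$ such that, under the AC model with $0\le p\le\frac{\tilde c_0}{\kappa^2\sqrt r}$, whenever $m\ge c_1\,dr\kappa^4\max\{\log\kappa+\log r,\,1\}\log d$, $$\|F_0F_0^\top-c^*X_\natural\|\le\frac{c_0\sigma_r}{\kappa}\qquad(\ast)$$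 holds with $c^*=1$ with probability at least $1-c_2\exp\!\big(-\tfrac{c_3m}{\kappa^4r}\big)-\exp(-(pm+d))$. 2. (RC) For every fixed $p\in(0,\tfrac12)$ there are constants $c_4,c_5,c_6>0$ depending only on $p$ and $c_0$ such that, under the RC model with rate $p$, whenever $m\ge c_4\,dr\kappa^4\max\{\log\kappa+\log r,\,1\}\log d$, there is a (deterministic) number $$c^*\in\Big[\sqrt{\tfrac1{2\pi}}\cdot\frac{\theta_{(0.5-p)/3}}{\theta_{1/2}},\ \sqrt{\tfrac2\pi}\cdot\frac{\theta_{1-(0.5-p)/3}}{\theta_{1/2}}\Big]$$ for which $(\ast)$ holds with probability at least $1-c_5\exp\!\big(-\tfrac{c_6m}{\kappa^4r}\big)$. -/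

import Mathlib

open MeasureTheory ProbabilityTheory
open scoped Matrix Matrix.Norms.L2Operator

namespace RobustSensing

noncomputable section

/-- The law of `|Z|` with `Z ∼ N(0,1)`. -/
def foldedNormal : Measure ℝ := (gaussianReal 0 1).map (fun x => |x|)

/-- The left quantile `θ_ε` of the folded normal law. -/
def foldedNormalQuantile (ε : ℝ) : ℝ := sInf {t : ℝ | ε ≤ cdf foldedNormal t}

/-- The sign function with the convention `sgn 0 = 1`. -/
def sgn (x : ℝ) : ℝ := if x < 0 then -1 else 1

/-- The trace inner product `⟨A, B⟩ = tr (Aᵀ B)`. -/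
def frobInner {d : ℕ} (A B : Matrix (Fin d) (Fin d) ℝ) : ℝ := (Aᵀ * B).trace

/-- `singVal X i` is the `i`-th largest singular value of `X`, with `i = 1, 2, …`. -/
def singVal {d : ℕ} (X : Matrix (Fin d) (Fin d) ℝ) (i : ℕ) : ℝ :=
  (Matrix.toEuclideanLin X).singularValues (i - 1)

/-- The condition number `κ = σ₁ / σ_r` of a matrix of rank `r`. -/
def condNumber {d : ℕ} (X : Matrix (Fin d) (Fin d) ℝ) (r : ℕ) : ℝ :=
  singVal X 1 / singVal X r

/-- The observations `y_i = ⟨A_i, X⟩ + s_i`. -/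
def observations {d m : ℕ} (A : Fin m → Matrix (Fin d) (Fin d) ℝ)
    (X : Matrix (Fin d) (Fin d) ℝ) (s : Fin m → ℝ) : Fin m → ℝ :=
  fun i => frobInner (A i) X + s i

/-- `ξ` is a median of `x_1, …, x_m`: at least half of the points are `≤ ξ` and at least half are
`≥ ξ`. (For even `m` this admits every point between the two middle order statistics.) -/
def IsSampleMedian {m : ℕ} (x : Fin m → ℝ) (ξ : ℝ) : Prop :=
  m ≤ 2 * (Finset.univ.filter fun i => x i ≤ ξ).card ∧
    m ≤ 2 * (Finset.univ.filter fun i => ξ ≤ x i).card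

/-- The matrix `D = (1/m) ∑ sgn(y_i) A_i`. -/
def spectralMatrix {d m : ℕ} (A : Fin m → Matrix (Fin d) (Fin d) ℝ) (y : Fin m → ℝ) :
    Matrix (Fin d) (Fin d) ℝ :=
  (1 / (m : ℝ)) • ∑ i, sgn (y i) • A i

/-- `F` is a possible output of the spectral initialization run with inner dimension `k`:
take an orthogonal eigendecomposition `D = V diag(ev) Vᵀ` with eigenvalues in decreasing order,
let `U` consist of the first `k` columns of `V`, put `B = U (Σ₊)^{1/2}` with `Σ` the `k` leading
eigenvalues, take a median `ξ` of the `|y_i|`, and return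
`√γ B` with `γ = ξ / (√(2/π) θ_{1/2})`. -/
def IsSpectralInit {d m k : ℕ} (hk : k ≤ d) (A : Fin m → Matrix (Fin d) (Fin d) ℝ)
    (y : Fin m → ℝ) (F : Matrix (Fin d) (Fin k) ℝ) : Prop :=
  ∃ (V : Matrix (Fin d) (Fin d) ℝ) (ev : Fin d → ℝ) (ξ : ℝ),
    V ∈ Matrix.orthogonalGroup (Fin d) ℝ ∧ Antitone ev ∧
    spectralMatrix A y = V * Matrix.diagonal ev * Vᵀ ∧
    IsSampleMedian (fun i => |y i|) ξ ∧
    F = √(ξ / (√(2 / Real.pi) * foldedNormalQuantile (1 / 2))) •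
      (V.submatrix id (Fin.castLE hk) *
        Matrix.diagonal fun j => √(max (ev (Fin.castLE hk j)) 0))

variable {Ω : Type*} [MeasurableSpace Ω]

/-- `A_1, …, A_m` are i.i.d. from the Gaussian orthogonal ensemble: they are symmetric, all entries
on and above the diagonals are independent, diagonal entries have law `N(0,1)` and entries above
the diagonal have law `N(0,1/2)`. -/
structure IsIIDGOE {d m : ℕ} (μ : Measure Ω) (A : Ω → Fin m → Matrix (Fin d) (Fin d) ℝ) :
    Prop where
  symm : ∀ ω i, (A ω i).IsSymm
  law_diag : ∀ i a, HasLaw (fun ω => A ω i a a) (gaussianReal 0 1) μ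
  law_offDiag : ∀ i a b, a < b → HasLaw (fun ω => A ω i a b) (gaussianReal 0 (1 / 2)) μ
  indep : iIndepFun
    (fun (q : Fin m × {ab : Fin d × Fin d // ab.1 ≤ ab.2}) ω => A ω q.1 q.2.1.1 q.2.1.2) μ

/-- Arbitrary corruption: the set of indices of nonzero entries of `s` is uniformly distributed
over the subsets of size `⌊p m⌋` and is independent of the sensing matrices. Nothing is assumed
on the values of the nonzero entries, which may depend on everything else. -/
structure IsAC {d m : ℕ} (μ : Measure Ω) (A : Ω → Fin m → Matrix (Fin d) (Fin d) ℝ)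
    (s : Ω → Fin m → ℝ) (p : ℝ) : Prop where
  law_support : HasLaw (fun ω => Function.support (s ω))
    (uniformOn {T : Set (Fin m) | T.ncard = ⌊p * m⌋₊}) μ
  indep : IndepFun (fun ω i a b => A ω i a b) (fun ω => Function.support (s ω)) μ

/-- Random corruption: the `s_i` are random variables, independent of each other and of the sensing
matrices, each of them nonzero with probability `p`. -/
structure IsRC {d m : ℕ} (μ : Measure Ω) (A : Ω → Fin m → Matrix (Fin d) (Fin d) ℝ)
    (s : Ω → Fin m → ℝ) (p : ℝ) : Prop where
  measurable : ∀ i, Measurable fun ω => s ω i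
  prob_ne_zero : ∀ i, μ {ω | s ω i ≠ 0} = ENNReal.ofReal p
  iindep : iIndepFun (fun i ω => s ω i) μ
  indep : IndepFun (fun ω i a b => A ω i a b) s μ

/-- `P` holds with probability at least `q`: it holds on an event of probability at least `q`.
(Nothing is asked about the measurability of `P` itself.) -/
def HoldsWithProb (μ : Measure Ω) (q : ℝ) (P : Ω → Prop) : Prop :=
  ∃ E : Set Ω, MeasurableSet E ∧ q ≤ μ.real E ∧ ∀ ω ∈ E, P ω

end

end RobustSensing

/-!
Write `X = N U` with `N = ‖X‖_F` and `U` of unit Frobenius norm, so that `y_i / N = g_i + s_i / N`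
with `g_i = ⟨A_i, U⟩` standard Gaussian.

*Mean of the spectral matrix.* For every matrix `W` the part of `⟨A_i, W⟩` that is uncorrelated
with `g_i` is independent of it, hence
`E[sgn (y_i) ⟨A_i, W⟩] = √(2/π) E[exp (-s_i² / (2 N²))] ⟨U, W⟩` (`IsIIDGOE.integral_sgn_mul`).
So `D` has mean `√(2/π) ψ U`, where the attenuation `ψ ∈ [1 - p, 1]` is `1` without corruption.
The summands are dominated by Gaussians and therefore sub-Gaussian, and a union bound over a
`1/2`-net of the unit ball turns this into concentration of `D` in operator norm
(`IsIndepModel.measureReal_norm_gt_le`); the `25 ^ d` pairs of net points are absorbed by the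
sample size.

*Median.* The average `F` of the cdfs of `|y_i| / N` crosses `1/2` at some `τ`, with slope bounded
below, because with probability at least `1 - p > 1/2` a measurement is uncorrupted
(`IsIndepModel.meanCdf_gap`). Hoeffding's inequality at two points near `τ` then confines all sample
medians. Since `F` lies between `ψ Φ` and `(1 - p) Φ + p`, where `Φ` is the folded normal cdf, `τ`
lies between the two quantiles of the statement, and `ψ τ ≤ (3/5) θ_{1 - (1/2 - p)/3}`
(`exists_threshold`); as `1/2 ≥ √(1/(2π))` and `3/5 ≤ √(2/π)`, the number
`c* = ψ τ / θ_{1/2}` is in the required interval.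

*Combination.* If `D` is close to `√(2/π) ψ U` and `ξ` to `τ N`, then `γ D` is close to `c* X`.
Discarding the negative eigenvalues and all but `k ≥ r` of the positive ones at most doubles the
error (`norm_truncation_sub_le`), since `c* X` is positive semidefinite of rank at most `k`. As
`N ≤ √r σ₁`, a deviation `η / (κ² √r)` of `D` and `η / κ²` of `ξ / N` suffice
(`IsSpectralInit.norm_sub_le_of_deviation`).

*Arbitrary corruption.* The comparison is with the uncorrupted sample. Conditionally on the
corrupted index set `T`, which is independent of the `A_i`, the sums `∑_{i ∈ T} |⟨A_i, W⟩|`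
concentrate, so that flipping signs on `T` moves `D` by `O(p)`
(`IsAC.measureReal_norm_sub_gt_le`), and the empirical cdf moves by at most `p`. Here `F = Φ`,
`τ = θ_{1/2}` and `c* = 1`.
-/

namespace RobustSensing

section

/-! ### The folded normal law -/

instance : IsProbabilityMeasure foldedNormal :=
  Measure.isProbabilityMeasure_map (by fun_prop)

lemma continuous_gaussianPDFReal (a : ℝ) : Continuous (gaussianPDFReal a 1) := by
  unfold gaussianPDFReal
  fun_prop

lemma gaussianPDFReal_neg (x : ℝ) : gaussianPDFReal 0 1 (-x) = gaussianPDFReal 0 1 x := by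
  simp [gaussianPDFReal]

lemma gaussianPDFReal_anti {x y : ℝ} (hx : 0 ≤ x) (hxy : x ≤ y) :
    gaussianPDFReal 0 1 y ≤ gaussianPDFReal 0 1 x := by
  simp only [gaussianPDFReal]
  gcongr

lemma cdf_foldedNormal_eq_real (t : ℝ) :
    cdf foldedNormal t = (gaussianReal 0 1).real {x | |x| ≤ t} := by
  rw [cdf_eq_real, foldedNormal, map_measureReal_apply (by fun_prop) measurableSet_Iic]
  rfl

lemma gaussianReal_real_abs_add_le (s : ℝ) {t : ℝ} (ht : 0 ≤ t) :
    (gaussianReal 0 1).real {x | |x + s| ≤ t} = ∫ x in (-t)..t, gaussianPDFReal s 1 x := by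
  have h1 : (gaussianReal 0 1).map (· + s) = gaussianReal s 1 := by
    rw [gaussianReal_map_add_const, zero_add]
  have h2 : {x : ℝ | |x + s| ≤ t} = (· + s) ⁻¹' Set.Icc (-t) t := by
    ext x
    exact abs_le (a := x + s)
  rw [h2, ← map_measureReal_apply (by fun_prop) measurableSet_Icc, h1, measureReal_def,
    gaussianReal_apply_eq_integral _ one_ne_zero, ENNReal.toReal_ofReal,
    integral_Icc_eq_integral_Ioc, intervalIntegral.integral_of_le (by linarith)]
  exact integral_nonneg fun x => gaussianPDFReal_nonneg _ _ _

lemma cdf_foldedNormal_eq_integral {t : ℝ} (ht : 0 ≤ t) :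
    cdf foldedNormal t = 2 * ∫ x in (0 : ℝ)..t, gaussianPDFReal 0 1 x := by
  have h := gaussianReal_real_abs_add_le 0 ht
  simp only [add_zero] at h
  have hi : ∀ a b, IntervalIntegrable (gaussianPDFReal 0 1) volume a b := fun a b =>
    (continuous_gaussianPDFReal 0).intervalIntegrable a b
  have h3 : ∫ x in (-t)..0, gaussianPDFReal 0 1 x = ∫ x in (0 : ℝ)..t, gaussianPDFReal 0 1 x := by
    have := intervalIntegral.integral_comp_neg (a := 0) (b := t) (gaussianPDFReal 0 1)
    simp only [gaussianPDFReal_neg, neg_zero] at this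
    exact this.symm
  rw [cdf_foldedNormal_eq_real, h, ← intervalIntegral.integral_add_adjacent_intervals (hi _ 0)
    (hi 0 _), h3]
  ring

lemma cdf_foldedNormal_sub {a b : ℝ} (ha : 0 ≤ a) (hab : a ≤ b) :
    cdf foldedNormal b - cdf foldedNormal a = 2 * ∫ x in a..b, gaussianPDFReal 0 1 x := by
  have hi : ∀ a b, IntervalIntegrable (gaussianPDFReal 0 1) volume a b := fun a b =>
    (continuous_gaussianPDFReal 0).intervalIntegrable a b
  rw [cdf_foldedNormal_eq_integral ha, cdf_foldedNormal_eq_integral (ha.trans hab),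
    ← intervalIntegral.integral_add_adjacent_intervals (hi 0 a) (hi a b)]
  ring

/-- The folded normal law has density at least `2 φ(b)` on `[0, b]`. -/
lemma mul_sub_le_cdf_foldedNormal_sub {a b : ℝ} (ha : 0 ≤ a) (hab : a ≤ b) :
    2 * gaussianPDFReal 0 1 b * (b - a) ≤ cdf foldedNormal b - cdf foldedNormal a := by
  rw [cdf_foldedNormal_sub ha hab]
  have h : ∫ _ in a..b, gaussianPDFReal 0 1 b ≤ ∫ x in a..b, gaussianPDFReal 0 1 x :=
    intervalIntegral.integral_mono_on hab (by simp)
      ((continuous_gaussianPDFReal 0).intervalIntegrable a b) fun x hx =>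
        gaussianPDFReal_anti (ha.trans hx.1) hx.2
  rw [intervalIntegral.integral_const, smul_eq_mul] at h
  linarith

lemma strictMonoOn_cdf_foldedNormal : StrictMonoOn (cdf foldedNormal) (Set.Ici 0) := by
  intro a ha b hb hab
  have h := mul_sub_le_cdf_foldedNormal_sub (Set.mem_Ici.1 ha) hab.le
  have h2 := gaussianPDFReal_pos 0 1 b one_ne_zero
  have : 0 < 2 * gaussianPDFReal 0 1 b * (b - a) := by
    have := sub_pos.2 hab
    positivity
  linarith

lemma cdf_foldedNormal_zero : cdf foldedNormal 0 = 0 := by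
  rw [cdf_foldedNormal_eq_integral le_rfl]; simp

lemma continuousOn_cdf_foldedNormal : ContinuousOn (cdf foldedNormal) (Set.Ici 0) := by
  have : Continuous fun t => 2 * ∫ x in (0 : ℝ)..t, gaussianPDFReal 0 1 x := by
    refine continuous_const.mul ?_
    exact intervalIntegral.continuous_primitive
      (fun a b => (continuous_gaussianPDFReal 0).intervalIntegrable a b) 0
  exact this.continuousOn.congr fun t ht => cdf_foldedNormal_eq_integral ht

lemma foldedNormalQuantile_spec {ε : ℝ} (h0 : 0 < ε) (h1 : ε < 1) :
    0 < foldedNormalQuantile ε ∧ cdf foldedNormal (foldedNormalQuantile ε) = ε := by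
  have hlim := tendsto_cdf_atTop foldedNormal
  obtain ⟨b, hb, hb0⟩ := ((hlim.eventually (lt_mem_nhds h1)).and
    (Filter.eventually_ge_atTop (0 : ℝ))).exists
  obtain ⟨t, ht, hte⟩ := intermediate_value_Icc hb0
    (continuousOn_cdf_foldedNormal.mono Set.Icc_subset_Ici_self)
    (show ε ∈ Set.Icc _ _ from ⟨by rw [cdf_foldedNormal_zero]; exact h0.le, hb.le⟩)
  have ht0 : 0 < t := by
    rcases ht.1.eq_or_lt with h | h
    · rw [← h, cdf_foldedNormal_zero] at hte; linarith
    · exact h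
  have hset : {u : ℝ | ε ≤ cdf foldedNormal u} = Set.Ici t := by
    ext u
    simp only [Set.mem_ofPred_eq, Set.mem_Ici]
    constructor
    · intro hu
      by_contra! hut
      rcases le_or_gt 0 u with h | h
      · have := strictMonoOn_cdf_foldedNormal h ht0.le hut
        linarith
      · have := monotone_cdf foldedNormal h.le
        rw [cdf_foldedNormal_zero] at this
        linarith
    · intro hu
      rw [← hte]
      exact monotone_cdf _ hu
  have : foldedNormalQuantile ε = t := by
    rw [foldedNormalQuantile, hset, csInf_Ici]
  rw [this]
  exact ⟨ht0, hte⟩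

/-- A nonnegative point lies to the right of the quantile as soon as its cdf exceeds the level. -/
lemma foldedNormalQuantile_le {ε t : ℝ} (h0 : 0 < ε) (h1 : ε < 1) (ht : 0 ≤ t)
    (h : ε ≤ cdf foldedNormal t) : foldedNormalQuantile ε ≤ t := by
  obtain ⟨hp, he⟩ := foldedNormalQuantile_spec h0 h1
  rw [← he] at h
  exact (strictMonoOn_cdf_foldedNormal.le_iff_le hp.le ht).1 h

lemma foldedNormalQuantile_mono {a b : ℝ} (ha : 0 < a) (hab : a ≤ b) (hb : b < 1) :
    foldedNormalQuantile a ≤ foldedNormalQuantile b := by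
  obtain ⟨hp, he⟩ := foldedNormalQuantile_spec (ha.trans_le hab) hb
  exact foldedNormalQuantile_le ha (hab.trans_lt hb) hp.le (by rw [he]; exact hab)

/-- The cdf of the folded normal law is concave on `[0, ∞)` and vanishes at `0`, so its slope
`G(t) / t` is nonincreasing. -/
lemma mul_cdf_foldedNormal_le {t T : ℝ} (ht : 0 ≤ t) (htT : t ≤ T) :
    t * cdf foldedNormal T ≤ T * cdf foldedNormal t := by
  rcases (ht.trans htT).eq_or_lt with hT | hT
  · have : t = 0 := le_antisymm (hT ▸ htT) ht
    simp [this, ← hT]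
  have hl1 : t / T ≤ 1 := (div_le_one hT).2 htT
  have hl0 : 0 ≤ t / T := by positivity
  have h1 : ∫ x in (0 : ℝ)..T, gaussianPDFReal 0 1 x ≤
      ∫ x in (0 : ℝ)..T, gaussianPDFReal 0 1 (t / T * x) := by
    refine intervalIntegral.integral_mono_on hT.le
      ((continuous_gaussianPDFReal 0).intervalIntegrable _ _)
      (((continuous_gaussianPDFReal 0).comp (by fun_prop)).intervalIntegrable _ _) fun x hx => ?_
    exact gaussianPDFReal_anti (mul_nonneg hl0 hx.1) (mul_le_of_le_one_left hx.1 hl1)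
  have h2 := intervalIntegral.mul_integral_comp_mul_left (a := 0) (b := T)
    (f := gaussianPDFReal 0 1) (t / T)
  rw [mul_zero, div_mul_cancel₀ _ hT.ne'] at h2
  rw [cdf_foldedNormal_eq_integral ht, cdf_foldedNormal_eq_integral hT.le, ← h2]
  have : t * (2 * ∫ x in (0 : ℝ)..T, gaussianPDFReal 0 1 x) ≤
      t * (2 * ∫ x in (0 : ℝ)..T, gaussianPDFReal 0 1 (t / T * x)) := by gcongr
  refine this.trans (le_of_eq ?_)
  field_simp

/-- Shifting a Gaussian by `s` decreases the mass of a centred interval at most by the factor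
`exp (-s² / 2)`: average the shifts by `s` and `-s` and use `cosh ≥ 1`. -/
lemma exp_mul_cdf_foldedNormal_le (s t : ℝ) :
    Real.exp (-s ^ 2 / 2) * cdf foldedNormal t ≤ (gaussianReal 0 1).real {x | |x + s| ≤ t} := by
  rcases lt_or_ge t 0 with ht | ht
  · have : cdf foldedNormal t = 0 := by
      refine le_antisymm ?_ (cdf_nonneg _ _)
      rw [← cdf_foldedNormal_zero]
      exact monotone_cdf _ ht.le
    rw [this, mul_zero]
    exact measureReal_nonneg
  have h0 : cdf foldedNormal t = ∫ x in (-t)..t, gaussianPDFReal 0 1 x := by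
    rw [cdf_foldedNormal_eq_real, ← gaussianReal_real_abs_add_le 0 ht]
    simp
  have hneg : ∫ x in (-t)..t, gaussianPDFReal s 1 x = ∫ x in (-t)..t, gaussianPDFReal s 1 (-x) := by
    have := intervalIntegral.integral_comp_neg (a := -t) (b := t) (gaussianPDFReal s 1)
    rw [neg_neg] at this
    exact this.symm
  have hi := (continuous_gaussianPDFReal s).intervalIntegrable (μ := volume) (-t) t
  have hi' := ((continuous_gaussianPDFReal s).comp continuous_neg).intervalIntegrable
    (μ := volume) (-t) t
  simp only [Function.comp_def] at hi'
  have hi0 := (continuous_gaussianPDFReal 0).intervalIntegrable (μ := volume) (-t) t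
  have key : ∫ x in (-t)..t, 2 * (Real.exp (-s ^ 2 / 2) * gaussianPDFReal 0 1 x) ≤
      ∫ x in (-t)..t, (gaussianPDFReal s 1 x + gaussianPDFReal s 1 (-x)) := by
    refine intervalIntegral.integral_mono_on (by linarith) ((hi0.const_mul _).const_mul _)
      (hi.add hi') fun x _ => ?_
    have e1 : gaussianPDFReal s 1 x + gaussianPDFReal s 1 (-x) =
        2 * (Real.exp (-s ^ 2 / 2) * gaussianPDFReal 0 1 x) * Real.cosh (s * x) := by
      simp only [gaussianPDFReal, Real.cosh_eq, NNReal.coe_one, mul_one, sub_zero]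
      rw [show -(x - s) ^ 2 / 2 = -s ^ 2 / 2 + -x ^ 2 / 2 + s * x by ring,
        show -(-x - s) ^ 2 / 2 = -s ^ 2 / 2 + -x ^ 2 / 2 + -(s * x) by ring]
      simp only [Real.exp_add]
      ring
    rw [e1]
    exact le_mul_of_one_le_right (mul_nonneg (by norm_num) (mul_nonneg (Real.exp_pos _).le
      (gaussianPDFReal_nonneg _ _ _))) (Real.one_le_cosh _)
  rw [intervalIntegral.integral_add hi hi', intervalIntegral.integral_const_mul,
    intervalIntegral.integral_const_mul, ← hneg] at key
  rw [gaussianReal_real_abs_add_le s ht, h0]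
  linarith

lemma measurable_sgn : Measurable sgn :=
  Measurable.ite measurableSet_Iio measurable_const measurable_const

lemma abs_sgn (x : ℝ) : |sgn x| = 1 := by
  unfold sgn; split_ifs <;> simp

/-- The identity `E[sgn(g + s) g] = √(2/π) exp (-s² / 2)` for `g ∼ N(0,1)`. -/
lemma integral_sgn_add_mul_gaussianReal (s : ℝ) :
    ∫ x, sgn (x + s) * x ∂(gaussianReal 0 1) = √(2 / Real.pi) * Real.exp (-s ^ 2 / 2) := by
  have hint : Integrable (fun x : ℝ => x) (gaussianReal 0 1) :=
    (memLp_id_gaussianReal 1).integrable (by norm_num)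
  have hx : ∫ x, x ∂(gaussianReal 0 1) = 0 := integral_id_gaussianReal
  -- `sgn (x + s) = 2 · 1_{x ≥ -s} - 1`, and the `-1` integrates to zero against `x`
  have h1 : ∫ x, sgn (x + s) * x ∂(gaussianReal 0 1) =
      2 * ∫ x in Set.Ici (-s), x ∂(gaussianReal 0 1) := by
    have : ∀ x : ℝ, sgn (x + s) * x = 2 * (Set.Ici (-s)).indicator (fun x => x) x - x := by
      intro x
      by_cases h : x + s < 0
      · have : x ∉ Set.Ici (-s) := by simp; linarith
        simp [sgn, h, this]
      · have : x ∈ Set.Ici (-s) := by simp; linarith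
        simp only [sgn, h, this, Set.indicator_of_mem, if_false]; ring
    simp_rw [this]
    rw [integral_sub ((hint.indicator measurableSet_Ici).const_mul 2) hint, hx, sub_zero,
      integral_const_mul, integral_indicator measurableSet_Ici]
  have h2 : ∫ x in Set.Ici (-s), x ∂(gaussianReal 0 1) = gaussianPDFReal 0 1 s := by
    rw [← integral_indicator measurableSet_Ici,
      integral_gaussianReal_eq_integral_smul one_ne_zero]
    have : ∀ x : ℝ, gaussianPDFReal 0 1 x • (Set.Ici (-s)).indicator (fun x => x) x =
        (Set.Ici (-s)).indicator (fun x => gaussianPDFReal 0 1 x * x) x := by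
      intro x
      by_cases h : x ∈ Set.Ici (-s) <;> simp [h]
    simp_rw [this]
    rw [integral_indicator measurableSet_Ici, integral_Ici_eq_integral_Ioi]
    have hd : ∀ x ∈ Set.Ici (-s), HasDerivAt (fun x => -gaussianPDFReal 0 1 x)
        (gaussianPDFReal 0 1 x * x) x := by
      intro x _
      simp only [gaussianPDFReal, NNReal.coe_one, mul_one, sub_zero]
      have h := ((((hasDerivAt_id x).pow 2).neg.div_const 2).exp.const_mul
        ((√(2 * Real.pi))⁻¹)).neg
      refine h.congr_deriv ?_
      simp; ring
    have hI : IntegrableOn (fun x => gaussianPDFReal 0 1 x * x) (Set.Ioi (-s)) := by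
      refine Integrable.integrableOn ?_
      have := (integrable_mul_exp_neg_mul_sq (b := 1 / 2) (by norm_num)).const_mul
        ((√(2 * Real.pi))⁻¹)
      refine this.congr (Filter.Eventually.of_forall fun x => ?_)
      simp only [gaussianPDFReal, NNReal.coe_one, mul_one, sub_zero]
      rw [show -(1 / 2) * x ^ 2 = -x ^ 2 / 2 by ring]
      ring
    have ht : Filter.Tendsto (fun x => -gaussianPDFReal 0 1 x) Filter.atTop (nhds 0) := by
      have h : Filter.Tendsto (fun x : ℝ => -x ^ 2 / 2) Filter.atTop Filter.atBot :=
        Filter.Tendsto.atBot_div_const (by norm_num)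
          (Filter.tendsto_neg_atTop_atBot.comp (Filter.tendsto_pow_atTop (by norm_num)))
      have h' := ((Real.tendsto_exp_atBot.comp h).const_mul ((√(2 * Real.pi))⁻¹)).neg
      simpa [gaussianPDFReal, Function.comp_def] using h'
    rw [integral_Ioi_of_hasDerivAt_of_tendsto' hd hI ht, gaussianPDFReal_neg]
    ring
  rw [h1, h2, gaussianPDFReal]
  have : √(2 / Real.pi) = 2 * (√(2 * Real.pi))⁻¹ := by
    have hp := Real.pi_pos
    rw [show 2 / Real.pi = 2 ^ 2 / (2 * Real.pi) by field_simp, Real.sqrt_div (by norm_num),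
      Real.sqrt_sq (by norm_num), div_eq_mul_inv]
  rw [this]
  simp [mul_assoc]

end

section

/-! ### Linear forms of the Gaussian orthogonal ensemble -/

/-- The on-and-above-diagonal positions of a `d × d` matrix. -/
abbrev TriuIdx (d : ℕ) := {ab : Fin d × Fin d // ab.1 ≤ ab.2}

/-- The upper triangle of a matrix, as a vector. -/
def triu {d : ℕ} (M : Matrix (Fin d) (Fin d) ℝ) : TriuIdx d → ℝ := fun q => M q.1.1 q.1.2

/-- The symmetric matrix with a given upper triangle. -/
def symOfTriu {d : ℕ} (v : TriuIdx d → ℝ) : Matrix (Fin d) (Fin d) ℝ :=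
  Matrix.of fun a b => v ⟨(min a b, max a b), min_le_max⟩

lemma symOfTriu_triu {d : ℕ} {M : Matrix (Fin d) (Fin d) ℝ} (hM : M.IsSymm) :
    symOfTriu (triu M) = M := by
  ext a b
  simp only [symOfTriu, triu, Matrix.of_apply]
  rcases le_total a b with h | h
  · simp [h]
  · simp only [h, min_eq_right, max_eq_left]
    exact hM.apply a b

lemma frobInner_eq_sum {d : ℕ} (A B : Matrix (Fin d) (Fin d) ℝ) :
    frobInner A B = ∑ x : Fin d × Fin d, A x.1 x.2 * B x.1 x.2 := by
  rw [frobInner, Matrix.trace, Fintype.sum_prod_type, Finset.sum_comm]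
  simp [Matrix.mul_apply]

lemma measurable_frobInner_symOfTriu {d : ℕ} (W : Matrix (Fin d) (Fin d) ℝ) :
    Measurable fun v : TriuIdx d → ℝ => frobInner (symOfTriu v) W := by
  simp only [frobInner_eq_sum, symOfTriu, Matrix.of_apply]
  fun_prop

variable {Ω : Type*} [MeasurableSpace Ω] {μ : Measure Ω} {d m : ℕ}
  {A : Ω → Fin m → Matrix (Fin d) (Fin d) ℝ}

namespace IsIIDGOE

lemma hasLaw_entry (h : IsIIDGOE μ A) (q : Fin m × TriuIdx d) :
    HasLaw (fun ω => A ω q.1 q.2.1.1 q.2.1.2)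
      (gaussianReal 0 (if q.2.1.1 = q.2.1.2 then 1 else 1 / 2)) μ := by
  obtain ⟨i, ⟨⟨a, b⟩, hab⟩⟩ := q
  rcases (show a ≤ b from hab).eq_or_lt with h' | h'
  · subst h'
    simpa using h.law_diag i a
  · simpa [h'.ne] using h.law_offDiag i a b h'

lemma hasGaussianLaw (h : IsIIDGOE μ A) :
    HasGaussianLaw (fun ω (q : Fin m × TriuIdx d) => A ω q.1 q.2.1.1 q.2.1.2) μ :=
  h.indep.hasGaussianLaw fun q => (h.hasLaw_entry q).hasGaussianLaw

lemma hasGaussianLaw_curry (h : IsIIDGOE μ A) :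
    HasGaussianLaw (fun ω i => triu (A ω i)) μ := by
  let L : (Fin m × TriuIdx d → ℝ) →ₗ[ℝ] (Fin m → TriuIdx d → ℝ) :=
    { toFun := fun v i q => v (i, q), map_add' := fun _ _ => rfl, map_smul' := fun _ _ => rfl }
  exact h.hasGaussianLaw.map_fun (LinearMap.toContinuousLinearMap L)

lemma memLp_two (h : IsIIDGOE μ A) (q : Fin m × TriuIdx d) :
    MemLp (fun ω => A ω q.1 q.2.1.1 q.2.1.2) 2 μ :=
  (h.hasLaw_entry q).hasGaussianLaw.memLp_two

lemma covariance_triu (h : IsIIDGOE μ A) (q q' : Fin m × TriuIdx d) :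
    cov[fun ω => A ω q.1 q.2.1.1 q.2.1.2, fun ω => A ω q'.1 q'.2.1.1 q'.2.1.2; μ] =
      if q = q' then (if q.2.1.1 = q.2.1.2 then 1 else 1 / 2) else 0 := by
  have := h.indep.isProbabilityMeasure
  split_ifs with h1 h2
  · subst h1
    rw [covariance_self (h.hasLaw_entry q).aemeasurable, (h.hasLaw_entry q).variance_eq]
    simp [h2]
  · subst h1
    rw [covariance_self (h.hasLaw_entry q).aemeasurable, (h.hasLaw_entry q).variance_eq]
    simp [h2]
  · exact (h.indep.indepFun h1).covariance_eq_zero (h.memLp_two q) (h.memLp_two q')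

/-- The matrices of an i.i.d. GOE sample are independent. -/
lemma iIndepFun_triu (h : IsIIDGOE μ A) : iIndepFun (fun i ω => triu (A ω i)) μ := by
  refine HasGaussianLaw.iIndepFun_of_covariance_eval
    (X := fun i (q : TriuIdx d) ω => A ω i q.1.1 q.1.2) h.hasGaussianLaw_curry fun i j hij k l => ?_
  have := h.covariance_triu (i, k) (j, l)
  simpa [hij] using this

lemma aemeasurable_triu (h : IsIIDGOE μ A) (i : Fin m) : AEMeasurable (fun ω => triu (A ω i)) μ :=
  aemeasurable_pi_lambda _ fun q => (h.hasLaw_entry (i, q)).aemeasurable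

lemma entry_eq (h : IsIIDGOE μ A) (i : Fin m) (a b : Fin d) (ω : Ω) :
    A ω i a b = triu (A ω i) ⟨(min a b, max a b), min_le_max⟩ := by
  conv_lhs => rw [← symOfTriu_triu (h.symm ω i)]
  rfl

lemma memLp_two_entry (h : IsIIDGOE μ A) (i : Fin m) (a b : Fin d) :
    MemLp (fun ω => A ω i a b) 2 μ := by
  simp only [h.entry_eq i a b]
  exact h.memLp_two (i, ⟨(min a b, max a b), min_le_max⟩)

lemma integral_entry (h : IsIIDGOE μ A) (i : Fin m) (a b : Fin d) :
    ∫ ω, A ω i a b ∂μ = 0 := by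
  simp only [h.entry_eq i a b]
  refine ((h.hasLaw_entry (i, ⟨(min a b, max a b), min_le_max⟩)).integral_eq).trans ?_
  exact integral_id_gaussianReal

lemma covariance_entry (h : IsIIDGOE μ A) (i : Fin m) (a b c e : Fin d) :
    cov[fun ω => A ω i a b, fun ω => A ω i c e; μ] =
      ((if a = c ∧ b = e then 1 else 0) + (if a = e ∧ b = c then 1 else 0)) / 2 := by
  simp only [h.entry_eq i a b, h.entry_eq i c e]
  refine (h.covariance_triu (i, ⟨(min a b, max a b), min_le_max⟩)
    (i, ⟨(min c e, max c e), min_le_max⟩)).trans ?_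
  simp only [Prod.mk.injEq, true_and, Subtype.mk.injEq]
  rcases lt_trichotomy a b with h1 | h1 | h1 <;> rcases lt_trichotomy c e with h2 | h2 | h2 <;>
    simp [h1.le, h2.le] <;> grind

/-- The linear forms `⟨A_i, V⟩`, `⟨A_i, W⟩` of a GOE matrix are jointly Gaussian. -/
lemma hasGaussianLaw_frobInner (h : IsIIDGOE μ A) (i : Fin m) (V W : Matrix (Fin d) (Fin d) ℝ) :
    HasGaussianLaw (fun ω => (frobInner (A ω i) V, frobInner (A ω i) W)) μ := by
  let L : Matrix (Fin d) (Fin d) ℝ → (Fin m → TriuIdx d → ℝ) →ₗ[ℝ] ℝ := fun V =>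
    { toFun := fun v => frobInner (symOfTriu (v i)) V
      map_add' := fun v w => by
        simp [frobInner_eq_sum, symOfTriu, add_mul, Finset.sum_add_distrib]
      map_smul' := fun c w => by
        simp [frobInner_eq_sum, symOfTriu, mul_assoc, Finset.mul_sum] }
  have := h.hasGaussianLaw_curry.map_fun (LinearMap.toContinuousLinearMap ((L V).prod (L W)))
  simpa [L, symOfTriu_triu (h.symm _ _)] using this

lemma integral_frobInner (h : IsIIDGOE μ A) (i : Fin m) (V : Matrix (Fin d) (Fin d) ℝ) :
    ∫ ω, frobInner (A ω i) V ∂μ = 0 := by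
  have := h.indep.isProbabilityMeasure
  simp only [frobInner_eq_sum]
  rw [integral_finsetSum _ fun x _ =>
    ((h.memLp_two_entry i x.1 x.2).integrable (by norm_num)).mul_const _]
  simp [integral_mul_const, h.integral_entry]

/-- Covariances of linear forms of a GOE matrix: only the symmetric part of the coefficient
matrix matters. -/
lemma covariance_frobInner (h : IsIIDGOE μ A) (i : Fin m) (V W : Matrix (Fin d) (Fin d) ℝ) :
    cov[fun ω => frobInner (A ω i) V, fun ω => frobInner (A ω i) W; μ] =
      (frobInner V W + frobInner V Wᵀ) / 2 := by
  have := h.indep.isProbabilityMeasure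
  simp only [frobInner_eq_sum (A _ i)]
  refine (covariance_fun_sum_fun_sum (X := fun (x : Fin d × Fin d) ω => A ω i x.1 x.2 * V x.1 x.2)
    (Y := fun (x : Fin d × Fin d) ω => A ω i x.1 x.2 * W x.1 x.2)
    (fun x => (h.memLp_two_entry i x.1 x.2).mul_const _)
    (fun x => (h.memLp_two_entry i x.1 x.2).mul_const _)).trans ?_
  simp only [covariance_mul_const_left, covariance_mul_const_right, h.covariance_entry]
  rw [frobInner_eq_sum, frobInner_eq_sum, ← Finset.sum_add_distrib, Finset.sum_div]
  refine Finset.sum_congr rfl fun x _ => ?_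
  have e : ∀ y : Fin d × Fin d,
      ((if x.1 = y.1 ∧ x.2 = y.2 then (1 : ℝ) else 0) +
        (if x.1 = y.2 ∧ x.2 = y.1 then 1 else 0)) / 2
        * V x.1 x.2 * W y.1 y.2 =
      (if x = y then V x.1 x.2 * W y.1 y.2 / 2 else 0) +
        (if (x.2, x.1) = y then V x.1 x.2 * W y.1 y.2 / 2 else 0) := by
    rintro ⟨c, e⟩
    obtain ⟨a, b⟩ := x
    simp only [Prod.mk.injEq, and_comm (a := b = c)]
    split_ifs <;> ring
  simp only [e, Finset.sum_add_distrib, Finset.sum_ite_eq, Finset.mem_univ, if_true,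
    Matrix.transpose_apply]
  ring

lemma hasLaw_frobInner (h : IsIIDGOE μ A) (i : Fin m) (V : Matrix (Fin d) (Fin d) ℝ) :
    HasLaw (fun ω => frobInner (A ω i) V)
      (gaussianReal 0 ((frobInner V V + frobInner V Vᵀ) / 2).toNNReal) μ where
  aemeasurable := (h.hasGaussianLaw_frobInner i V V).fst.aemeasurable
  map_eq := by
    have h1 := (h.hasGaussianLaw_frobInner i V V).fst
    rw [h1.map_eq_gaussianReal, h.integral_frobInner, ← covariance_self h1.aemeasurable,
      h.covariance_frobInner]

end IsIIDGOE

end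

section

/-! ### Sub-Gaussian concentration for variables dominated by Gaussians -/

/-- A variance proxy valid, after centring, for every variable dominated in absolute value by a
centred Gaussian of variance at most one. -/
noncomputable def proxy : NNReal := (8 * Real.exp 10).toNNReal

lemma coe_proxy : (proxy : ℝ) = 8 * Real.exp 10 := Real.coe_toNNReal _ (by positivity)

lemma proxy_pos : (0 : ℝ) < proxy := by rw [coe_proxy]; positivity

lemma exp_le_one_add_add_sq_mul_exp_abs (x : ℝ) : Real.exp x ≤ 1 + x + x ^ 2 * Real.exp |x| := by
  have h := Complex.norm_exp_sub_sum_le_norm_mul_exp (x : ℂ) 2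
  simp only [Finset.sum_range_succ, Finset.sum_range_zero, zero_add, pow_zero, Nat.factorial,
    pow_one, Nat.cast_one, div_one, Complex.norm_real, Real.norm_eq_abs, sq_abs] at h
  norm_num at h
  have h2 : Complex.exp x - (1 + x) = ((Real.exp x - (1 + x) : ℝ) : ℂ) := by push_cast; rfl
  rw [h2, Complex.norm_real, Real.norm_eq_abs] at h
  linarith [le_abs_self (Real.exp x - (1 + x))]

variable {Ω : Type*} [MeasurableSpace Ω] {μ : Measure Ω}

lemma integrable_exp_mul_abs_of_hasLaw {g : Ω → ℝ} {v : NNReal}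
    (hg : HasLaw g (gaussianReal 0 v) μ) (t : ℝ) :
    Integrable (fun ω => Real.exp (t * |g ω|)) μ := by
  have hi : ∀ t : ℝ, Integrable (fun ω => Real.exp (t * g ω)) μ := fun t => by
    have := integrable_exp_mul_gaussianReal (μ := 0) (v := v) t
    rw [← hg.map_eq] at this
    exact this.comp_aemeasurable hg.aemeasurable
  refine ((hi t).add (hi (-t))).mono' ?_ (Filter.Eventually.of_forall fun ω => ?_)
  · have := hg.aemeasurable
    exact (AEMeasurable.exp (by fun_prop)).aestronglyMeasurable
  · rw [Real.norm_eq_abs, Real.abs_exp]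
    rcases abs_cases (g ω) with ⟨h, _⟩ | ⟨h, _⟩ <;> rw [h]
    · exact le_add_of_nonneg_right (Real.exp_pos _).le
    · rw [mul_neg, ← neg_mul]
      exact le_add_of_nonneg_left (Real.exp_pos _).le

lemma integral_exp_mul_abs_le {g : Ω → ℝ} {v : NNReal} (hv : v ≤ 1)
    (hg : HasLaw g (gaussianReal 0 v) μ) (t : ℝ) :
    ∫ ω, Real.exp (t * |g ω|) ∂μ ≤ 2 * Real.exp (t ^ 2 / 2) := by
  have hi : ∀ t : ℝ, Integrable (fun ω => Real.exp (t * g ω)) μ := fun t => by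
    have := integrable_exp_mul_gaussianReal (μ := 0) (v := v) t
    rw [← hg.map_eq] at this
    exact this.comp_aemeasurable hg.aemeasurable
  have hm : ∀ t : ℝ, ∫ ω, Real.exp (t * g ω) ∂μ ≤ Real.exp (t ^ 2 / 2) := fun t => by
    have := mgf_gaussianReal hg.map_eq t
    rw [mgf] at this
    rw [this]
    have hv' : (v : ℝ) ≤ 1 := by exact_mod_cast hv
    gcongr
    nlinarith [sq_nonneg t]
  calc ∫ ω, Real.exp (t * |g ω|) ∂μ
      ≤ ∫ ω, (Real.exp (t * g ω) + Real.exp (-t * g ω)) ∂μ := by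
        refine integral_mono (integrable_exp_mul_abs_of_hasLaw hg t) ((hi t).add (hi (-t)))
          fun ω => ?_
        rcases abs_cases (g ω) with ⟨h, _⟩ | ⟨h, _⟩ <;> simp only [h]
        · exact le_add_of_nonneg_right (Real.exp_pos _).le
        · rw [mul_neg, ← neg_mul]
          exact le_add_of_nonneg_left (Real.exp_pos _).le
    _ = _ := integral_add (hi t) (hi (-t))
    _ ≤ _ := by
        have h1 := hm t
        have h2 := hm (-t)
        rw [neg_sq] at h2
        linarith

lemma integrable_of_abs_le_gaussian {Z g : Ω → ℝ} {v : NNReal}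
    (hg : HasLaw g (gaussianReal 0 v) μ) (hZ : AEMeasurable Z μ) (h : ∀ ω, |Z ω| ≤ |g ω|) :
    Integrable Z μ := by
  refine (integrable_exp_mul_abs_of_hasLaw hg 1).mono' hZ.aestronglyMeasurable
    (Filter.Eventually.of_forall fun ω => ?_)
  rw [Real.norm_eq_abs, one_mul]
  have := Real.add_one_le_exp |g ω|
  linarith [h ω]

lemma integral_abs_le_four {Z g : Ω → ℝ} {v : NNReal} (hv : v ≤ 1)
    (hg : HasLaw g (gaussianReal 0 v) μ) (hZ : AEMeasurable Z μ) (h : ∀ ω, |Z ω| ≤ |g ω|) :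
    ∫ ω, |Z ω| ∂μ ≤ 4 := by
  have h1 : ∫ ω, |Z ω| ∂μ ≤ ∫ ω, Real.exp (1 * |g ω|) ∂μ := by
    refine integral_mono (integrable_of_abs_le_gaussian hg hZ h).abs
      (integrable_exp_mul_abs_of_hasLaw hg 1) fun ω => ?_
    rw [one_mul]
    have := Real.add_one_le_exp |g ω|
    linarith [h ω]
  have h2 := integral_exp_mul_abs_le hv hg 1
  have h3 : Real.exp (1 ^ 2 / 2) ≤ 2 := by
    rw [one_pow, ← Real.le_log_iff_exp_le (by norm_num)]
    linarith [Real.log_two_gt_d9]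
  linarith

/-- A variable dominated in absolute value by a centred Gaussian of variance at most one is
sub-Gaussian after centring. -/
lemma hasSubgaussianMGF_of_abs_le_gaussian [IsProbabilityMeasure μ] {Z g : Ω → ℝ} {v : NNReal}
    (hv : v ≤ 1) (hg : HasLaw g (gaussianReal 0 v) μ) (hZ : AEMeasurable Z μ)
    (h : ∀ ω, |Z ω| ≤ |g ω|) :
    HasSubgaussianMGF (fun ω => Z ω - ∫ ω, Z ω ∂μ) proxy μ := by
  have hint := integrable_of_abs_le_gaussian hg hZ h
  have hmean : |∫ ω, Z ω ∂μ| ≤ 4 :=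
    (abs_integral_le_integral_abs).trans (integral_abs_le_four hv hg hZ h)
  set a := ∫ ω, Z ω ∂μ with ha
  have hY : ∀ ω, |Z ω - a| ≤ |g ω| + 4 := fun ω =>
    (abs_sub _ _).trans (add_le_add (h ω) hmean)
  have hdom : ∀ t ω, Real.exp (t * (Z ω - a)) ≤ Real.exp (4 * |t|) * Real.exp (|t| * |g ω|) := by
    intro t ω
    rw [← Real.exp_add]
    gcongr
    calc t * (Z ω - a) ≤ |t * (Z ω - a)| := le_abs_self _
      _ = |t| * |Z ω - a| := abs_mul _ _
      _ ≤ |t| * (|g ω| + 4) := by gcongr; exact hY ω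
      _ = _ := by ring
  have hI : ∀ t, Integrable (fun ω => Real.exp (t * (Z ω - a))) μ := by
    intro t
    refine ((integrable_exp_mul_abs_of_hasLaw hg |t|).const_mul (Real.exp (4 * |t|))).mono'
      (AEMeasurable.exp (by fun_prop)).aestronglyMeasurable
      (Filter.Eventually.of_forall fun ω => ?_)
    rw [Real.norm_eq_abs, Real.abs_exp]
    exact hdom t ω
  refine ⟨hI, fun t => ?_⟩
  rw [mgf, coe_proxy]
  have h10 : (11 : ℝ) ≤ Real.exp 10 := by linarith [Real.add_one_le_exp (10 : ℝ)]
  rcases le_or_gt |t| 1 with ht | ht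
  · -- for `|t| ≤ 1` expand to second order; the linear term vanishes
    have hpt : ∀ ω, Real.exp (t * (Z ω - a)) ≤
        1 + t * (Z ω - a) + 2 * t ^ 2 * (Real.exp 8 * Real.exp (2 * |g ω|)) := by
      intro ω
      refine (exp_le_one_add_add_sq_mul_exp_abs _).trans ?_
      have h1 : (Z ω - a) ^ 2 ≤ 2 * Real.exp |Z ω - a| := by
        have := Real.quadratic_le_exp_of_nonneg (abs_nonneg (Z ω - a))
        rw [sq_abs] at this
        linarith [abs_nonneg (Z ω - a)]
      have h2 : Real.exp |t * (Z ω - a)| ≤ Real.exp |Z ω - a| := by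
        rw [Real.exp_le_exp, abs_mul]
        exact mul_le_of_le_one_left (abs_nonneg _) ht
      have h3 : Real.exp |Z ω - a| * Real.exp |Z ω - a| ≤ Real.exp 8 * Real.exp (2 * |g ω|) := by
        rw [← Real.exp_add, ← Real.exp_add, Real.exp_le_exp]
        linarith [hY ω]
      have : (t * (Z ω - a)) ^ 2 * Real.exp |t * (Z ω - a)| ≤
          2 * t ^ 2 * (Real.exp 8 * Real.exp (2 * |g ω|)) := by
        calc (t * (Z ω - a)) ^ 2 * Real.exp |t * (Z ω - a)|
            ≤ t ^ 2 * (2 * Real.exp |Z ω - a|) * Real.exp |Z ω - a| := by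
              rw [mul_pow]; gcongr
          _ = 2 * t ^ 2 * (Real.exp |Z ω - a| * Real.exp |Z ω - a|) := by ring
          _ ≤ _ := by gcongr
      linarith
    have hg2 := (integrable_exp_mul_abs_of_hasLaw hg 2).const_mul (Real.exp 8)
    have hlin : Integrable (fun ω => 1 + t * (Z ω - a)) μ :=
      (integrable_const 1).add ((hint.sub (integrable_const a)).const_mul t)
    have h0 : ∫ ω, (1 + t * (Z ω - a)) ∂μ = 1 := by
      refine (integral_add (integrable_const 1)
        ((hint.sub (integrable_const a)).const_mul t)).trans ?_
      rw [integral_const_mul, integral_sub' hint (integrable_const a)]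
      simp [ha]
    have hle := integral_exp_mul_abs_le hv hg 2
    calc ∫ ω, Real.exp (t * (Z ω - a)) ∂μ
        ≤ ∫ ω, (1 + t * (Z ω - a) + 2 * t ^ 2 * (Real.exp 8 * Real.exp (2 * |g ω|))) ∂μ :=
          integral_mono (hI t) (hlin.add (hg2.const_mul _)) hpt
      _ = 1 + 2 * t ^ 2 * (Real.exp 8 * ∫ ω, Real.exp (2 * |g ω|) ∂μ) := by
          rw [integral_add hlin (hg2.const_mul _), h0, integral_const_mul, integral_const_mul]
      _ ≤ 1 + 2 * t ^ 2 * (Real.exp 8 * (2 * Real.exp (2 ^ 2 / 2))) := by gcongr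
      _ = 8 * Real.exp 10 * t ^ 2 / 2 + 1 := by
          rw [show (10 : ℝ) = 8 + 2 ^ 2 / 2 by norm_num, Real.exp_add]; ring
      _ ≤ _ := Real.add_one_le_exp _
  · -- for `|t| > 1` the crude bound `|Z - E Z| ≤ |g| + 4` is enough
    have hle := integral_exp_mul_abs_le hv hg |t|
    have ht2 : |t| ≤ t ^ 2 := by rw [← sq_abs]; nlinarith
    calc ∫ ω, Real.exp (t * (Z ω - a)) ∂μ
        ≤ ∫ ω, Real.exp (4 * |t|) * Real.exp (|t| * |g ω|) ∂μ :=
          integral_mono (hI t) ((integrable_exp_mul_abs_of_hasLaw hg |t|).const_mul _) (hdom t)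
      _ = Real.exp (4 * |t|) * ∫ ω, Real.exp (|t| * |g ω|) ∂μ := integral_const_mul _ _
      _ ≤ Real.exp (4 * |t|) * (Real.exp 1 * Real.exp (|t| ^ 2 / 2)) := by
          gcongr
          refine hle.trans ?_
          gcongr
          linarith [Real.add_one_le_exp (1 : ℝ)]
      _ = Real.exp (4 * |t| + (1 + |t| ^ 2 / 2)) := by rw [Real.exp_add, Real.exp_add]
      _ ≤ _ := by
          gcongr
          rw [sq_abs]
          nlinarith [sq_nonneg t]

lemma _root_.ProbabilityTheory.HasSubgaussianMGF.mono {Z : Ω → ℝ} {c c' : NNReal}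
    (h : HasSubgaussianMGF Z c μ) (hc : c ≤ c') : HasSubgaussianMGF Z c' μ :=
  ⟨h.integrable_exp_mul, fun t => (h.mgf_le t).trans (by gcongr)⟩

/-- Two-sided tail bound for a partial sum of independent sub-Gaussian variables. -/
lemma measureReal_abs_sum_ge_le {m : ℕ} {Y : Fin m → Ω → ℝ} {c : NNReal}
    (hind : iIndepFun Y μ) (hY : ∀ i, HasSubgaussianMGF (Y i) c μ)
    (T : Finset (Fin m)) {t : ℝ} (ht : 0 ≤ t) :
    μ.real {ω | m * t ≤ |∑ i ∈ T, Y i ω|} ≤ 2 * Real.exp (-(m * t ^ 2 / (2 * c))) := by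
  have := hind.isProbabilityMeasure
  have h1 : HasSubgaussianMGF (fun ω => ∑ i ∈ T, Y i ω) (m * c) μ := by
    refine (HasSubgaussianMGF.sum_of_iIndepFun hind (c := fun _ => c) (s := T)
      fun i _ => hY i).mono ?_
    rw [Finset.sum_const, nsmul_eq_mul]
    gcongr
    simpa using Finset.card_le_univ T
  have hmt : 0 ≤ m * t := by positivity
  have e : Real.exp (-(m * t) ^ 2 / (2 * ((m * c : NNReal) : ℝ))) ≤
      Real.exp (-(m * t ^ 2 / (2 * c))) := by
    refine le_of_eq ?_
    congr 1
    rcases Nat.eq_zero_or_pos m with h | h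
    · simp [h]
    · have : (m : ℝ) ≠ 0 := by positivity
      push_cast
      rw [neg_div]
      congr 1
      rw [show ((m : ℝ) * t) ^ 2 = m * (m * t ^ 2) by ring,
        show 2 * ((m : ℝ) * c) = m * (2 * c) by ring, mul_div_mul_left _ _ this]
  have h2 := h1.measure_ge_le hmt
  have h3 := h1.neg.measure_ge_le hmt
  refine (measureReal_mono (s₂ := {ω | m * t ≤ ∑ i ∈ T, Y i ω} ∪
    {ω | m * t ≤ (-fun ω => ∑ i ∈ T, Y i ω) ω}) fun ω hω => ?_).trans
    ((measureReal_union_le _ _).trans ?_)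
  · simpa [le_abs] using hω
  · linarith

end

section

/-! ### Nets and the operator norm -/

/-- The unit ball of `ℝ^d` has a `1/2`-net with at most `5 ^ d` points. -/
lemma exists_half_net (d : ℕ) : ∃ S : Finset (EuclideanSpace ℝ (Fin d)),
    S.card ≤ 5 ^ d ∧ (∀ u ∈ S, ‖u‖ ≤ 1) ∧
      ∀ x : EuclideanSpace ℝ (Fin d), ‖x‖ ≤ 1 → ∃ u ∈ S, ‖x - u‖ ≤ 1 / 2 := by
  classical
  let Q : Finset (EuclideanSpace ℝ (Fin d)) → Prop := fun S =>
    (∀ u ∈ S, ‖u‖ ≤ 1) ∧ ∀ u ∈ S, ∀ v ∈ S, u ≠ v → 1 / 2 ≤ ‖u - v‖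
  have hcard : ∀ S, Q S → S.card ≤ 5 ^ d := by
    intro S hS
    have hinj : Function.Injective fun u : EuclideanSpace ℝ (Fin d) => (2 : ℝ) • u :=
      smul_right_injective _ two_ne_zero
    have := Besicovitch.card_le_of_separated (S.image fun u => (2 : ℝ) • u)
      (by
        simp only [Finset.mem_image]
        rintro _ ⟨u, hu, rfl⟩
        rw [norm_smul, Real.norm_two]
        linarith [hS.1 u hu])
      (by
        simp only [Finset.mem_image]
        rintro _ ⟨u, hu, rfl⟩ _ ⟨v, hv, rfl⟩ huv
        rw [← smul_sub, norm_smul, Real.norm_two]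
        linarith [hS.2 u hu v hv fun h => huv (by rw [h])])
    rwa [Finset.card_image_of_injective _ hinj, finrank_euclideanSpace_fin] at this
  -- a separated set of maximal cardinality is a net
  let P : ℕ → Prop := fun n => ∃ S, Q S ∧ S.card = n
  have hP0 : P 0 := ⟨∅, by simp [Q], rfl⟩
  obtain ⟨S, hS, hSn⟩ : P (Nat.findGreatest P (5 ^ d)) :=
    Nat.findGreatest_spec (Nat.zero_le _) hP0
  refine ⟨S, hcard S hS, hS.1, fun x hx => ?_⟩
  by_contra! hcon
  have hxS : x ∉ S := fun h => by
    have := hcon x h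
    rw [sub_self, norm_zero] at this
    norm_num at this
  have hQ : Q (insert x S) := by
    refine ⟨fun u hu => ?_, fun u hu v hv huv => ?_⟩
    · rcases Finset.mem_insert.1 hu with rfl | hu
      exacts [hx, hS.1 u hu]
    · rcases Finset.mem_insert.1 hu with hu' | hu' <;>
        rcases Finset.mem_insert.1 hv with hv' | hv'
      · exact absurd (hu'.trans hv'.symm) huv
      · rw [hu']; exact (hcon v hv').le
      · rw [hv', norm_sub_rev]; exact (hcon u hu').le
      · exact hS.2 u hu' v hv' huv
  have h1 := Nat.le_findGreatest (P := P) (hcard _ hQ) ⟨_, hQ, rfl⟩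
  rw [Finset.card_insert_of_notMem hxS, ← hSn] at h1
  omega

lemma opNorm_le_of_half_net {E F : Type*} [NormedAddCommGroup E] [NormedSpace ℝ E]
    [NormedAddCommGroup F] [NormedSpace ℝ F] {S : Set E}
    (hS : ∀ x : E, ‖x‖ ≤ 1 → ∃ u ∈ S, ‖x - u‖ ≤ 1 / 2) (L : E →L[ℝ] F) {a : ℝ} (ha : 0 ≤ a)
    (h : ∀ u ∈ S, ‖L u‖ ≤ a) : ‖L‖ ≤ 2 * a := by
  have key : ‖L‖ ≤ a + ‖L‖ * (1 / 2) := by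
    refine ContinuousLinearMap.opNorm_le_of_unit_norm (by positivity) fun x hx => ?_
    obtain ⟨u, hu, hxu⟩ := hS x hx.le
    calc ‖L x‖ = ‖L u + L (x - u)‖ := by rw [← map_add, add_sub_cancel]
      _ ≤ ‖L u‖ + ‖L (x - u)‖ := norm_add_le _ _
      _ ≤ a + ‖L‖ * (1 / 2) := by
        refine add_le_add (h u hu) ((L.le_opNorm _).trans ?_)
        gcongr
  linarith

lemma inner_toEuclideanLin {d : ℕ} (M : Matrix (Fin d) (Fin d) ℝ) (u v : EuclideanSpace ℝ (Fin d)) :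
    inner ℝ v (Matrix.toEuclideanLin M u) = frobInner M (Matrix.vecMulVec v u) := by
  rw [frobInner_eq_sum, Fintype.sum_prod_type, PiLp.inner_apply]
  refine Finset.sum_congr rfl fun a _ => ?_
  simp only [Matrix.toLpLin_apply, Matrix.mulVec, dotProduct,
    RCLike.inner_apply, conj_trivial, Matrix.vecMulVec_apply, Finset.sum_mul]
  exact Finset.sum_congr rfl fun b _ => by ring

/-- Discretization of the operator norm of a matrix by the rank-one forms of a net. -/
lemma norm_le_of_half_net {d : ℕ} {S : Finset (EuclideanSpace ℝ (Fin d))}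
    (hS : ∀ x : EuclideanSpace ℝ (Fin d), ‖x‖ ≤ 1 → ∃ u ∈ S, ‖x - u‖ ≤ 1 / 2)
    (M : Matrix (Fin d) (Fin d) ℝ) {a : ℝ} (ha : 0 ≤ a)
    (h : ∀ u ∈ S, ∀ v ∈ S, |frobInner M (Matrix.vecMulVec v u)| ≤ a) : ‖M‖ ≤ 4 * a := by
  rw [Matrix.l2_opNorm_def]
  have : 4 * a = 2 * (2 * a) := by ring
  rw [this]
  refine opNorm_le_of_half_net (S := (S : Set _)) hS _ (by positivity) fun u hu => ?_
  have h1 := opNorm_le_of_half_net (S := (S : Set _)) hS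
    (innerSL ℝ (Matrix.toEuclideanLin M u)) ha fun v hv => by
      rw [innerSL_apply_apply, real_inner_comm, inner_toEuclideanLin, Real.norm_eq_abs]
      exact h u hu v hv
  rwa [innerSL_apply_norm] at h1

lemma frobInner_vecMulVec_self {d : ℕ} (u v : EuclideanSpace ℝ (Fin d)) :
    frobInner (Matrix.vecMulVec v u) (Matrix.vecMulVec v u) = ‖v‖ ^ 2 * ‖u‖ ^ 2 := by
  rw [frobInner_eq_sum, Fintype.sum_prod_type, EuclideanSpace.real_norm_sq_eq,
    EuclideanSpace.real_norm_sq_eq, Finset.sum_mul_sum]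
  exact Finset.sum_congr rfl fun a _ => Finset.sum_congr rfl fun b _ => by
    simp only [Matrix.vecMulVec_apply]; ring

lemma frobInner_vecMulVec_transpose {d : ℕ} (u v : EuclideanSpace ℝ (Fin d)) :
    frobInner (Matrix.vecMulVec v u) (Matrix.vecMulVec v u)ᵀ = inner ℝ v u ^ 2 := by
  rw [frobInner_eq_sum, Fintype.sum_prod_type, sq, PiLp.inner_apply, Finset.sum_mul_sum]
  exact Finset.sum_congr rfl fun a _ => Finset.sum_congr rfl fun b _ => by
    simp only [Matrix.vecMulVec_apply, Matrix.transpose_apply, RCLike.inner_apply, conj_trivial]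
    ring

lemma frobInner_vecMulVec_le_one {d : ℕ} {u v : EuclideanSpace ℝ (Fin d)} (hu : ‖u‖ ≤ 1)
    (hv : ‖v‖ ≤ 1) :
    ((frobInner (Matrix.vecMulVec v u) (Matrix.vecMulVec v u) +
      frobInner (Matrix.vecMulVec v u) (Matrix.vecMulVec v u)ᵀ) / 2).toNNReal ≤ 1 := by
  rw [frobInner_vecMulVec_self, frobInner_vecMulVec_transpose, Real.toNNReal_le_one]
  have h1 : ‖v‖ * ‖u‖ ≤ 1 := mul_le_one₀ hv (norm_nonneg _) hu
  have h2 := abs_real_inner_le_norm v u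
  have h3 : inner ℝ v u ^ 2 ≤ (‖v‖ * ‖u‖) ^ 2 := by rw [← sq_abs]; gcongr
  have h4 : (‖v‖ * ‖u‖) ^ 2 ≤ 1 := pow_le_one₀ (by positivity) h1
  rw [← mul_pow]
  linarith

end

section

/-! ### Singular values and spectral truncation -/

section SingularValues

variable {d : ℕ} (X : Matrix (Fin d) (Fin d) ℝ)

lemma finrank_range_toEuclideanLin :
    Module.finrank ℝ (LinearMap.range (Matrix.toEuclideanLin X)) = X.rank := by
  rw [Matrix.rank_eq_finrank_range_toLin X (PiLp.basisFun 2 ℝ (Fin d)) (PiLp.basisFun 2 ℝ (Fin d)),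
    ← Matrix.toLpLin_eq_toLin]

lemma singVal_nonneg (i : ℕ) : 0 ≤ singVal X i := LinearMap.singularValues_nonneg _ _

variable {X} in
lemma singVal_pos {r : ℕ} (hr : 1 ≤ r) (h : X.rank = r) : 0 < singVal X r := by
  rw [singVal, LinearMap.singularValues_pos_iff_lt_finrank_range, finrank_range_toEuclideanLin, h]
  omega

lemma singVal_le_one (r : ℕ) : singVal X r ≤ singVal X 1 :=
  LinearMap.singularValues_antitone _ (by simp)

/-- The largest singular value bounds the operator norm. -/
lemma norm_le_singVal_one : ‖X‖ ≤ singVal X 1 := by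
  have hn : Module.finrank ℝ (EuclideanSpace ℝ (Fin d)) = d := finrank_euclideanSpace_fin
  rw [Matrix.l2_opNorm_def]
  refine ContinuousLinearMap.opNorm_le_bound _ (singVal_nonneg X 1) fun x => ?_
  change ‖Matrix.toEuclideanLin X x‖ ≤ _
  set T := Matrix.toEuclideanLin X with hT
  refine le_of_sq_le_sq ?_ (mul_nonneg (singVal_nonneg X 1) (norm_nonneg _))
  set b := T.isSymmetric_adjoint_comp_self.eigenvectorBasis hn
  have h1 : ‖T x‖ ^ 2 = inner ℝ x ((LinearMap.adjoint T ∘ₗ T) x) := by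
    rw [LinearMap.comp_apply, LinearMap.adjoint_inner_right, real_inner_self_eq_norm_sq]
  have h2 : inner ℝ x ((LinearMap.adjoint T ∘ₗ T) x) =
      ∑ i : Fin d, T.singularValues i ^ 2 * (b.repr x i) ^ 2 := by
    rw [← b.repr.inner_map_map, PiLp.inner_apply]
    refine Finset.sum_congr rfl fun i _ => ?_
    rw [LinearMap.IsSymmetric.eigenvectorBasis_apply_self_apply, T.sq_singularValues_fin hn]
    simp only [RCLike.inner_apply, conj_trivial, RCLike.ofReal_real_eq_id, id_eq]
    ring
  rw [h1, h2, mul_pow, ← b.repr.norm_map x, EuclideanSpace.real_norm_sq_eq, Finset.mul_sum]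
  refine Finset.sum_le_sum fun i _ => ?_
  gcongr
  · exact T.singularValues_nonneg _
  · exact T.singularValues_antitone (Nat.zero_le _)

/-- `‖X‖_F² ≤ rank X · σ₁²`. -/
lemma frobInner_self_le {r : ℕ} (h : X.rank = r) : frobInner X X ≤ r * singVal X 1 ^ 2 := by
  have hn : Module.finrank ℝ (EuclideanSpace ℝ (Fin d)) = d := finrank_euclideanSpace_fin
  set T := Matrix.toEuclideanLin X with hT
  have h1 : frobInner X X = LinearMap.trace ℝ _ (LinearMap.adjoint T ∘ₗ T) := by
    rw [LinearMap.trace_eq_sum_inner _ (EuclideanSpace.basisFun (Fin d) ℝ), frobInner_eq_sum,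
      Fintype.sum_prod_type, Finset.sum_comm]
    refine Finset.sum_congr rfl fun j _ => ?_
    rw [LinearMap.comp_apply, LinearMap.adjoint_inner_right, real_inner_self_eq_norm_sq,
      EuclideanSpace.real_norm_sq_eq]
    refine Finset.sum_congr rfl fun i _ => ?_
    simp [hT, Matrix.toLpLin_apply, sq]
  rw [h1, T.isSymmetric_adjoint_comp_self.trace_eq_sum_eigenvalues hn]
  have h2 : ∀ i : Fin d, T.isSymmetric_adjoint_comp_self.eigenvalues hn i ≤
      if (i : ℕ) < r then singVal X 1 ^ 2 else 0 := by
    intro i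
    rw [← T.sq_singularValues_fin hn]
    split_ifs with hi
    · have := T.singularValues_antitone (Nat.zero_le i)
      have h0 := T.singularValues_nonneg i
      exact pow_le_pow_left₀ h0 this 2
    · have : T.singularValues i = 0 := by
        rw [LinearMap.singularValues_eq_zero_iff_le_finrank_range, hT,
          finrank_range_toEuclideanLin, h]
        omega
      rw [this]; simp
  simp only [RCLike.ofReal_real_eq_id, id_eq]
  refine (Finset.sum_le_sum fun i _ => h2 i).trans ?_
  rw [← Finset.sum_filter, Finset.sum_const, nsmul_eq_mul]
  gcongr
  have : (Finset.univ.filter fun i : Fin d => (i : ℕ) < r).card ≤ (Finset.range r).card := by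
    refine Finset.card_le_card_of_injOn (fun i => (i : ℕ)) (fun i hi => ?_)
      (fun i _ j _ hij => Fin.ext hij)
    simpa using hi
  simpa using this

variable {X} in
lemma frobInner_self_pos (h : X ≠ 0) : 0 < frobInner X X := by
  rw [frobInner_eq_sum]
  refine lt_of_le_of_ne (Finset.sum_nonneg fun x _ => mul_self_nonneg _) fun h0 => h ?_
  rw [eq_comm, Finset.sum_eq_zero_iff_of_nonneg fun x _ => mul_self_nonneg _] at h0
  ext a b
  simpa using h0 (a, b) (Finset.mem_univ _)

end SingularValues

section Truncation

variable {d : ℕ}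

lemma abs_dotProduct_mulVec_le (M : Matrix (Fin d) (Fin d) ℝ) (x : Fin d → ℝ) :
    |x ⬝ᵥ M *ᵥ x| ≤ ‖M‖ * (x ⬝ᵥ x) := by
  have h := M.l2_opNorm_mulVec (WithLp.toLp 2 x)
  have h2 := abs_real_inner_le_norm (WithLp.toLp 2 (M *ᵥ x)) (WithLp.toLp 2 x)
  rw [EuclideanSpace.inner_toLp_toLp] at h2
  simp only [star_trivial] at h2
  have h3 : x ⬝ᵥ x = ‖WithLp.toLp 2 x‖ ^ 2 := by
    rw [EuclideanSpace.real_norm_sq_eq, dotProduct]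
    exact Finset.sum_congr rfl fun i _ => (sq _).symm
  rw [h3]
  calc _ ≤ _ := h2
    _ ≤ (‖M‖ * ‖WithLp.toLp 2 x‖) * ‖WithLp.toLp 2 x‖ := by gcongr; exact h
    _ = _ := by ring

/-- If `X` has rank at most `j`, some nonzero vector of `ℝ^{j+1}` is annihilated by `X * P` for
every matrix `P` with `j + 1` columns. -/
lemma exists_mulVec_mul_eq_zero (X : Matrix (Fin d) (Fin d) ℝ) {n : ℕ} (h : X.rank < n)
    (P : Matrix (Fin d) (Fin n) ℝ) : ∃ w : Fin n → ℝ, w ≠ 0 ∧ X *ᵥ (P *ᵥ w) = 0 := by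
  have h1 := LinearMap.finrank_range_add_finrank_ker (X * P).mulVecLin
  have h2 : (X * P).rank ≤ X.rank := Matrix.rank_mul_le_left X P
  rw [← Matrix.rank, Module.finrank_fin_fun] at h1
  have h3 : 0 < Module.finrank ℝ (LinearMap.ker (X * P).mulVecLin) := by omega
  obtain ⟨w, hw⟩ := Module.finrank_pos_iff_exists_ne_zero.1 h3
  refine ⟨w, fun h => hw (Subtype.ext h), ?_⟩
  have := w.2
  rw [LinearMap.mem_ker, Matrix.mulVecLin_apply] at this
  rw [Matrix.mulVec_mulVec]
  exact this

/-- Eigenvalues of a perturbation of `c X`, for `X ⪰ 0` of rank `r`: they are at least `-ε`, and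
those beyond the `r`-th are at most `ε`, because the leading eigenvectors span a space that meets
the kernel of `X`. -/
lemma eigenvalue_bounds {X D V : Matrix (Fin d) (Fin d) ℝ} {ev : Fin d → ℝ} {γ c ε : ℝ}
    (hX : X.PosSemidef) (hV : Vᵀ * V = 1) (hev : Antitone ev)
    (hD : D = V * Matrix.diagonal ev * Vᵀ) (hγ : 0 ≤ γ) (hc : 0 ≤ c) (hε : ‖γ • D - c • X‖ ≤ ε) :
    (∀ j, -ε ≤ γ * ev j) ∧ ∀ j : Fin d, X.rank ≤ j → γ * ev j ≤ ε := by
  have hVD : Vᵀ * D * V = Matrix.diagonal ev := by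
    rw [hD]
    calc Vᵀ * (V * Matrix.diagonal ev * Vᵀ) * V = (Vᵀ * V) * Matrix.diagonal ev * (Vᵀ * V) := by
          simp only [Matrix.mul_assoc]
      _ = _ := by rw [hV, Matrix.one_mul, Matrix.mul_one]
  -- restriction of the quadratic form of `γ D - c X` to the span of selected eigenvectors
  have hquad : ∀ (n : ℕ) (e : Fin n → Fin d), Function.Injective e → ∀ w : Fin n → ℝ,
      let x := V.submatrix id e *ᵥ w
      x ⬝ᵥ x = ∑ i, w i ^ 2 ∧
        x ⬝ᵥ (γ • D - c • X) *ᵥ x = ∑ i, γ * ev (e i) * w i ^ 2 - c * (x ⬝ᵥ X *ᵥ x) := by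
    intro n e he w x
    have hgen : ∀ M : Matrix (Fin d) (Fin d) ℝ,
        x ⬝ᵥ M *ᵥ x = w ⬝ᵥ (Vᵀ * M * V).submatrix e e *ᵥ w := by
      intro M
      have : (Vᵀ * M * V).submatrix e e = (V.submatrix id e)ᵀ * M * V.submatrix id e := by
        ext i j; simp [Matrix.mul_apply]
      rw [this]
      simp only [x, ← Matrix.mulVec_mulVec]
      rw [Matrix.dotProduct_mulVec w, Matrix.vecMul_transpose]
    constructor
    · have := hgen 1
      rw [Matrix.one_mulVec, Matrix.mul_one, hV, Matrix.submatrix_one _ he,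
        Matrix.one_mulVec] at this
      rw [this, dotProduct]
      exact Finset.sum_congr rfl fun i _ => (sq _).symm
    · have := hgen D
      rw [hVD, Matrix.submatrix_diagonal _ _ he] at this
      rw [Matrix.sub_mulVec, Matrix.smul_mulVec, Matrix.smul_mulVec, dotProduct_sub,
        dotProduct_smul, dotProduct_smul, this, smul_eq_mul, smul_eq_mul, dotProduct,
        Finset.mul_sum]
      congr 1
      refine Finset.sum_congr rfl fun i _ => ?_
      rw [Matrix.mulVec_diagonal, Function.comp_apply]
      ring
  have hXnn : ∀ x : Fin d → ℝ, 0 ≤ x ⬝ᵥ X *ᵥ x := fun x => by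
    simpa using hX.dotProduct_mulVec_nonneg x
  constructor
  · intro j
    obtain ⟨h1, h2⟩ := hquad 1 (fun _ => j) (Function.injective_of_subsingleton _) (fun _ => 1)
    have h3 := abs_dotProduct_mulVec_le (γ • D - c • X)
      (V.submatrix id (fun _ : Fin 1 => j) *ᵥ fun _ => 1)
    rw [h2, h1] at h3
    simp only [Finset.univ_unique, Finset.sum_singleton, one_pow, mul_one] at h3
    have h4 := mul_nonneg hc (hXnn (V.submatrix id (fun _ : Fin 1 => j) *ᵥ fun _ => 1))
    have := (abs_le.1 h3).1
    linarith
  · intro j hj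
    have hjd : (j : ℕ) + 1 ≤ d := j.2
    obtain ⟨w, hw, hXw⟩ := exists_mulVec_mul_eq_zero X (Nat.lt_succ_of_le hj)
      (V.submatrix id (Fin.castLE hjd))
    obtain ⟨h1, h2⟩ := hquad _ (Fin.castLE hjd) (Fin.castLE_injective hjd) w
    have h3 := abs_dotProduct_mulVec_le (γ • D - c • X) (V.submatrix id (Fin.castLE hjd) *ᵥ w)
    rw [h2, h1, hXw, dotProduct_zero, mul_zero, sub_zero] at h3
    have hpos : 0 < ∑ i, w i ^ 2 := by
      refine lt_of_le_of_ne (Finset.sum_nonneg fun i _ => sq_nonneg _) fun h0 => hw ?_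
      rw [eq_comm, Finset.sum_eq_zero_iff_of_nonneg fun i _ => sq_nonneg _] at h0
      ext i
      simpa using h0 i (Finset.mem_univ _)
    have h4 : γ * ev j * ∑ i, w i ^ 2 ≤ ∑ i, γ * ev (Fin.castLE hjd i) * w i ^ 2 := by
      rw [Finset.mul_sum]
      refine Finset.sum_le_sum fun i _ => ?_
      have : ev j ≤ ev (Fin.castLE hjd i) := hev (Fin.le_def.2 (by simp; omega))
      gcongr
    have h5 : γ * ev j * ∑ i, w i ^ 2 ≤ ε * ∑ i, w i ^ 2 :=
      h4.trans ((le_abs_self _).trans (h3.trans (by gcongr)))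
    exact le_of_mul_le_mul_right h5 hpos

lemma norm_le_one_of_transpose_mul_self {V : Matrix (Fin d) (Fin d) ℝ} (hV : Vᵀ * V = 1) :
    ‖V‖ ≤ 1 := by
  have h := V.l2_opNorm_conjTranspose_mul_self
  rw [Matrix.conjTranspose_eq_transpose_of_trivial, hV] at h
  have h1 : ‖(1 : Matrix (Fin d) (Fin d) ℝ)‖ ≤ 1 := by
    rw [← Matrix.diagonal_one, Matrix.l2_opNorm_diagonal]
    exact (pi_norm_le_iff_of_nonneg zero_le_one).2 fun i => by simp
  nlinarith [norm_nonneg V]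

/-- Keeping the nonnegative part of the `k ≥ rank X` leading eigenvalues at most doubles the
distance to `c X`. -/
lemma norm_truncation_sub_le {X D V : Matrix (Fin d) (Fin d) ℝ} {ev : Fin d → ℝ} {γ c ε : ℝ}
    {k : ℕ} (hk : k ≤ d) (hXk : X.rank ≤ k)
    (hX : X.PosSemidef) (hV : Vᵀ * V = 1) (hev : Antitone ev)
    (hD : D = V * Matrix.diagonal ev * Vᵀ) (hγ : 0 ≤ γ) (hc : 0 ≤ c) (hε : ‖γ • D - c • X‖ ≤ ε)
    {F : Matrix (Fin d) (Fin k) ℝ}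
    (hF : F = √γ • (V.submatrix id (Fin.castLE hk) *
      Matrix.diagonal fun j => √(max (ev (Fin.castLE hk j)) 0))) :
    ‖F * Fᵀ - c • X‖ ≤ 2 * ε := by
  obtain ⟨hlow, hup⟩ := eigenvalue_bounds hX hV hev hD hγ hc hε
  have hε0 : 0 ≤ ε := (norm_nonneg _).trans hε
  have hFF : F * Fᵀ = γ •
      (V * Matrix.diagonal (fun j : Fin d => if (j : ℕ) < k then max (ev j) 0 else 0)
      * Vᵀ) := by
    rw [hF, Matrix.transpose_smul, Matrix.smul_mul, Matrix.mul_smul, smul_smul,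
      Real.mul_self_sqrt hγ]
    congr 1
    ext a b
    rw [Matrix.transpose_mul, Matrix.diagonal_transpose, ← Matrix.mul_assoc,
      Matrix.mul_assoc (V.submatrix _ _), Matrix.diagonal_mul_diagonal]
    rw [Matrix.mul_apply, Matrix.mul_apply]
    simp only [Matrix.mul_diagonal, Matrix.submatrix_apply, id_eq,
      Matrix.transpose_apply]
    have : ∀ j : Fin d, V a j * (if (j : ℕ) < k then max (ev j) 0 else 0) * V b j =
        if (j : ℕ) < k then V a j * max (ev j) 0 * V b j else 0 := by
      intro j; split_ifs <;> simp
    simp_rw [this]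
    rw [← Finset.sum_filter]
    refine Finset.sum_bij (fun j _ => Fin.castLE hk j) (by simp)
      (fun i _ j _ h => Fin.castLE_injective hk h) (fun j hj => ?_) (fun j _ => ?_)
    · simp only [Finset.mem_filter, Finset.mem_univ, true_and] at hj
      exact ⟨⟨j, hj⟩, Finset.mem_univ _, rfl⟩
    · rw [Real.mul_self_sqrt (le_max_right _ _)]
  have hdiff : ‖F * Fᵀ - γ • D‖ ≤ ε := by
    have e : F * Fᵀ - γ • D = V * Matrix.diagonal
        (fun j : Fin d => γ * ((if (j : ℕ) < k then max (ev j) 0 else 0) - ev j)) * Vᵀ := by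
      rw [hFF, hD, ← smul_sub, ← Matrix.sub_mul, ← Matrix.mul_sub, Matrix.diagonal_sub]
      rw [← Matrix.smul_mul, ← Matrix.mul_smul, ← Matrix.diagonal_smul]
      rfl
    have hV1 := norm_le_one_of_transpose_mul_self hV
    have hV1' : ‖Vᵀ‖ ≤ 1 := by
      rw [← Matrix.conjTranspose_eq_transpose_of_trivial, Matrix.l2_opNorm_conjTranspose]
      exact hV1
    have hdiag : ‖(Matrix.diagonal
        (fun j : Fin d => γ * ((if (j : ℕ) < k then max (ev j) 0 else 0) - ev j)) :
          Matrix (Fin d) (Fin d) ℝ)‖ ≤ ε := by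
      rw [Matrix.l2_opNorm_diagonal]
      refine (pi_norm_le_iff_of_nonneg hε0).2 fun j => ?_
      rw [Real.norm_eq_abs, abs_le, mul_sub]
      split_ifs with hj
      · rcases le_total (ev j) 0 with h | h
        · rw [max_eq_right h]
          have := hlow j
          have := mul_nonpos_of_nonneg_of_nonpos hγ h
          constructor <;> linarith
        · rw [max_eq_left h]
          constructor <;> linarith
      · have h1 := hup j (by omega)
        have h2 := hlow j
        constructor <;> linarith
    rw [e]
    calc _ ≤ _ := Matrix.l2_opNorm_mul _ _
      _ ≤ (‖V‖ * ε) * ‖Vᵀ‖ := by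
        gcongr
        exact (Matrix.l2_opNorm_mul _ _).trans (by gcongr)
      _ ≤ (1 * ε) * 1 := by gcongr
      _ = ε := by ring
  calc ‖F * Fᵀ - c • X‖ = ‖(F * Fᵀ - γ • D) + (γ • D - c • X)‖ := by rw [sub_add_sub_cancel]
    _ ≤ _ := norm_add_le _ _
    _ ≤ _ := by linarith

end Truncation

end

section

/-! ### One corrupted measurement -/

variable {Ω : Type*} [MeasurableSpace Ω] {μ : Measure Ω} {d m : ℕ}
  {A : Ω → Fin m → Matrix (Fin d) (Fin d) ℝ} {s : Ω → Fin m → ℝ}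

/-- A GOE sample together with shifts `s_i` such that the pairs `(A_i, s_i)` are independent
and each `s_i` is independent of `A_i`. It covers randomly corrupted measurements, and
uncorrupted ones with `s = 0`. -/
structure IsIndepModel (μ : Measure Ω) (A : Ω → Fin m → Matrix (Fin d) (Fin d) ℝ)
    (s : Ω → Fin m → ℝ) : Prop where
  goe : IsIIDGOE μ A
  aemeasurable : ∀ i, AEMeasurable (fun ω => s ω i) μ
  indep : ∀ i, IndepFun (fun ω => triu (A ω i)) (fun ω => s ω i) μ
  iindep : iIndepFun (fun i ω => (triu (A ω i), s ω i)) μ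

lemma IsIIDGOE.isIndepModel_zero (h : IsIIDGOE μ A) : IsIndepModel μ A (fun _ _ => 0) where
  goe := h
  aemeasurable _ := aemeasurable_const
  indep _ := by
    have := h.indep.isProbabilityMeasure
    exact indepFun_const_right _ _
  iindep := h.iIndepFun_triu.comp (fun _ v => (v, (0 : ℝ))) fun _ => by fun_prop

lemma IsRC.isIndepModel {p : ℝ} (h : IsIIDGOE μ A) (hs : IsRC μ A s p) : IsIndepModel μ A s := by
  have := h.indep.isProbabilityMeasure
  have hm : ∀ i, AEMeasurable (fun ω => s ω i) μ := fun i => (hs.measurable i).aemeasurable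
  have hind : IndepFun (fun ω i => triu (A ω i)) (fun ω i => s ω i) μ := by
    refine hs.indep.comp (φ := fun (B : Fin m → Fin d → Fin d → ℝ) i (q : TriuIdx d) =>
      B i q.1.1 q.1.2) (ψ := id) ?_ measurable_id
    fun_prop
  have hind1 : ∀ i, IndepFun (fun ω => triu (A ω i)) (fun ω => s ω i) μ := fun i =>
    hind.comp (φ := fun v : Fin m → TriuIdx d → ℝ => v i) (ψ := fun v : Fin m → ℝ => v i)
      (measurable_pi_apply i) (measurable_pi_apply i)
  have hA : AEMeasurable (fun ω i => triu (A ω i)) μ :=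
    aemeasurable_pi_lambda _ fun i => h.aemeasurable_triu i
  have hS : AEMeasurable (fun ω i => s ω i) μ := aemeasurable_pi_lambda _ hm
  refine ⟨h, hm, hind1, ?_⟩
  rw [iIndepFun_iff_map_fun_eq_pi_map fun i => (h.aemeasurable_triu i).prodMk (hm i)]
  have hpair : ∀ i, μ.map (fun ω => (triu (A ω i), s ω i)) =
      (μ.map fun ω => triu (A ω i)).prod (μ.map fun ω => s ω i) := fun i =>
    (indepFun_iff_map_prod_eq_prod_map_map (h.aemeasurable_triu i) (hm i)).1 (hind1 i)
  simp_rw [hpair]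
  have hp1 : ∀ i, IsProbabilityMeasure (μ.map fun ω => triu (A ω i)) := fun i =>
    Measure.isProbabilityMeasure_map (h.aemeasurable_triu i)
  have hp2 : ∀ i, IsProbabilityMeasure (μ.map fun ω => s ω i) := fun i =>
    Measure.isProbabilityMeasure_map (hm i)
  have hmp := measurePreserving_arrowProdEquivProdArrow (TriuIdx d → ℝ) ℝ (Fin m)
    (fun i => μ.map fun ω => triu (A ω i)) (fun i => μ.map fun ω => s ω i)
  rw [← (MeasurableEquiv.arrowProdEquivProdArrow _ _ _).map_measurableEquiv_injective.eq_iff,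
    hmp.map_eq, ← h.iIndepFun_triu.map_fun_eq_pi_map fun i => h.aemeasurable_triu i,
    ← hs.iindep.map_fun_eq_pi_map hm,
    ← (indepFun_iff_map_prod_eq_prod_map_map hA hS).1 hind,
    AEMeasurable.map_map_of_aemeasurable (MeasurableEquiv.measurable _).aemeasurable
      (aemeasurable_pi_lambda _ fun i => (h.aemeasurable_triu i).prodMk (hm i))]
  rfl

/-- Integration against independent variables: freeze one of them, integrate over the other. -/
lemma integral_eq_of_indepFun [IsProbabilityMeasure μ] {α β : Type*} [MeasurableSpace α]
    [MeasurableSpace β] {a : Ω → α} {b : Ω → β} (ha : AEMeasurable a μ) (hb : AEMeasurable b μ)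
    (hab : IndepFun a b μ) {f : α × β → ℝ} (hf : Measurable f)
    (hint : Integrable (fun ω => f (a ω, b ω)) μ) :
    ∫ ω, f (a ω, b ω) ∂μ = ∫ ω', ∫ ω, f (a ω, b ω') ∂μ ∂μ := by
  have hp1 := Measure.isProbabilityMeasure_map ha
  have hp2 := Measure.isProbabilityMeasure_map hb
  have hmap := (indepFun_iff_map_prod_eq_prod_map_map ha hb).1 hab
  have hI : Integrable f ((μ.map a).prod (μ.map b)) := by
    rw [← hmap]
    exact (integrable_map_measure hf.aestronglyMeasurable (ha.prodMk hb)).2 hint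
  have h1 : ∫ ω, f (a ω, b ω) ∂μ = ∫ z, f z ∂((μ.map a).prod (μ.map b)) := by
    rw [← hmap, integral_map (ha.prodMk hb) hf.aestronglyMeasurable]
  rw [h1, integral_prod_symm _ hI]
  rw [integral_map hb (hf.stronglyMeasurable.integral_prod_left').aestronglyMeasurable]
  congr 1
  ext ω'
  have hf' : Measurable fun x => f (x, b ω') := hf.comp (measurable_id.prodMk measurable_const)
  rw [integral_map ha hf'.aestronglyMeasurable]

section Single

lemma exp_neg_sq_le_one (c N : ℝ) : Real.exp (-(c / N) ^ 2 / 2) ≤ 1 := by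
  rw [Real.exp_le_one_iff]
  have := sq_nonneg (c / N)
  linarith

/-- The cdf, at `t N`, of `|N g + c|` for independent `g ∼ N(0,1)` and `c ∼ σ`. -/
noncomputable def shiftedCdf (σ : Measure ℝ) (N t : ℝ) : ℝ :=
  ((gaussianReal 0 1).prod σ).real {z | |N * z.1 + z.2| ≤ t * N}

variable {σ : Measure ℝ} [IsProbabilityMeasure σ] {N : ℝ}

lemma measurableSet_abs_add_le (N t : ℝ) :
    MeasurableSet {z : ℝ × ℝ | |N * z.1 + z.2| ≤ t * N} :=
  measurableSet_le (by fun_prop) (by fun_prop)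

lemma abs_mul_le_mul_iff (hN : 0 < N) (x t : ℝ) : |N * x| ≤ t * N ↔ |x| ≤ t := by
  rw [abs_mul, abs_of_pos hN, mul_comm t, mul_le_mul_iff_right₀ hN]

/-- On the event that the shift vanishes, the shifted law dominates the folded normal law. -/
lemma mul_sub_le_shiftedCdf_sub (hN : 0 < N) {a b : ℝ} (hab : a ≤ b) :
    σ.real {0} * (cdf foldedNormal b - cdf foldedNormal a) ≤
      shiftedCdf σ N b - shiftedCdf σ N a := by
  have hsub : {z : ℝ × ℝ | |N * z.1 + z.2| ≤ a * N} ⊆ {z : ℝ × ℝ | |N * z.1 + z.2| ≤ b * N} :=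
    fun z hz => le_trans hz (mul_le_mul_of_nonneg_right hab hN.le)
  have hsub' : {x : ℝ | |x| ≤ a} ⊆ {x : ℝ | |x| ≤ b} := fun x hx => le_trans hx hab
  have hma : MeasurableSet {x : ℝ | |x| ≤ a} := measurableSet_le (by fun_prop) (by fun_prop)
  rw [shiftedCdf, shiftedCdf, ← measureReal_sdiff hsub (measurableSet_abs_add_le N a),
    cdf_foldedNormal_eq_real, cdf_foldedNormal_eq_real, ← measureReal_sdiff hsub' hma,
    mul_comm, ← measureReal_prod_prod]
  refine measureReal_mono fun z hz => ?_
  obtain ⟨⟨h1, h2⟩, h3⟩ := hz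
  have h3 : z.2 = 0 := h3
  refine ⟨?_, fun h => h2 ?_⟩
  · change |N * z.1 + z.2| ≤ b * N
    rw [h3, add_zero, abs_mul_le_mul_iff hN]
    exact h1
  · change |N * z.1 + z.2| ≤ a * N at h
    rw [h3, add_zero, abs_mul_le_mul_iff hN] at h
    exact h

lemma shiftedCdf_le (hN : 0 < N) (t : ℝ) :
    shiftedCdf σ N t ≤ σ.real {0} * cdf foldedNormal t + (1 - σ.real {0}) := by
  have hc : σ.real {0}ᶜ = 1 - σ.real {0} := by
    rw [measureReal_compl (measurableSet_singleton _), probReal_univ]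
  rw [shiftedCdf, cdf_foldedNormal_eq_real, mul_comm (σ.real {0}), ← measureReal_prod_prod, ← hc]
  have h1 : σ.real {0}ᶜ = ((gaussianReal 0 1).prod σ).real (Set.univ ×ˢ {0}ᶜ) := by
    rw [measureReal_prod_prod, probReal_univ, one_mul]
  rw [h1]
  refine (measureReal_mono (s₂ := {x : ℝ | |x| ≤ t} ×ˢ {0} ∪ Set.univ ×ˢ {0}ᶜ)
    fun z hz => ?_).trans (measureReal_union_le _ _)
  by_cases h : z.2 = 0
  · refine Or.inl ⟨?_, h⟩
    change |N * z.1 + z.2| ≤ t * N at hz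
    rw [h, add_zero, abs_mul_le_mul_iff hN] at hz
    exact hz
  · exact Or.inr ⟨Set.mem_univ _, h⟩

/-- The mean attenuation `E[exp (-c² / (2 N²))]` caused by the shift `c ∼ σ`. -/
noncomputable def attenuation (σ : Measure ℝ) (N : ℝ) : ℝ := ∫ c, Real.exp (-(c / N) ^ 2 / 2) ∂σ

lemma integrable_exp_neg_sq (N : ℝ) : Integrable (fun c => Real.exp (-(c / N) ^ 2 / 2)) σ := by
  refine Integrable.of_bound (by fun_prop) 1 (Filter.Eventually.of_forall fun c => ?_)
  rw [Real.norm_eq_abs, Real.abs_exp]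
  exact exp_neg_sq_le_one c N

lemma attenuation_le_one : attenuation σ N ≤ 1 := by
  have := integral_mono (integrable_exp_neg_sq (σ := σ) N) (integrable_const 1)
    fun c => exp_neg_sq_le_one c N
  simpa [attenuation] using this

lemma measureReal_zero_le_attenuation : σ.real {0} ≤ attenuation σ N := by
  rw [← integral_indicator_one (measurableSet_singleton _), attenuation]
  refine integral_mono ((integrable_const 1).indicator (measurableSet_singleton _))
    (integrable_exp_neg_sq N) fun c => ?_
  by_cases h : c = 0
  · simp [h]
  · simp [h, Real.exp_nonneg]

lemma attenuation_mul_cdf_le (hN : 0 < N) (t : ℝ) :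
    attenuation σ N * cdf foldedNormal t ≤ shiftedCdf σ N t := by
  have hm := measurableSet_abs_add_le N t
  have hI : Integrable ({z : ℝ × ℝ | |N * z.1 + z.2| ≤ t * N}.indicator (1 : ℝ × ℝ → ℝ))
      ((gaussianReal 0 1).prod σ) := (integrable_const (1 : ℝ)).indicator hm
  rw [shiftedCdf, ← integral_indicator_one hm, integral_prod_symm _ hI, attenuation,
    ← integral_mul_const]
  refine integral_mono ((integrable_exp_neg_sq N).mul_const _) hI.integral_prod_right fun c => ?_
  have h1 : ∀ x : ℝ, {z : ℝ × ℝ | |N * z.1 + z.2| ≤ t * N}.indicator (1 : ℝ × ℝ → ℝ) (x, c) =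
      {x : ℝ | |x + c / N| ≤ t}.indicator 1 x := by
    intro x
    have : |N * x + c| ≤ t * N ↔ |x + c / N| ≤ t := by
      rw [← abs_mul_le_mul_iff hN (x + c / N), mul_add, mul_div_cancel₀ _ hN.ne']
    by_cases h : |x + c / N| ≤ t
    · rw [Set.indicator_of_mem (by exact this.2 h), Set.indicator_of_mem (by exact h)]; rfl
    · rw [Set.indicator_of_notMem (by exact fun h' => h (this.1 h')),
        Set.indicator_of_notMem (by exact h)]
  simp only [h1]
  rw [integral_indicator_one (measurableSet_le (by fun_prop) (by fun_prop))]
  exact exp_mul_cdf_foldedNormal_le _ _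

end Single

lemma sgn_mul_of_pos {N : ℝ} (hN : 0 < N) (x : ℝ) : sgn (N * x) = sgn x := by
  simp [sgn, mul_neg_iff, hN, not_lt.2 hN.le]

/-- For a unit symmetric `U`, the form `⟨A_i, U⟩` is standard Gaussian. -/
lemma IsIIDGOE.hasLaw_unit (h : IsIIDGOE μ A) {U : Matrix (Fin d) (Fin d) ℝ} (hU : U.IsSymm)
    (hU1 : frobInner U U = 1) (i : Fin m) :
    HasLaw (fun ω => frobInner (A ω i) U) (gaussianReal 0 1) μ := by
  have := h.hasLaw_frobInner i U
  rw [hU.eq, hU1] at this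
  simpa using this

lemma frobInner_sub_right (B V W : Matrix (Fin d) (Fin d) ℝ) :
    frobInner B (V - W) = frobInner B V - frobInner B W := by
  simp [frobInner, Matrix.mul_sub]

lemma frobInner_smul_right (c : ℝ) (B V : Matrix (Fin d) (Fin d) ℝ) :
    frobInner B (c • V) = c * frobInner B V := by
  simp [frobInner]

lemma frobInner_smul_left (c : ℝ) (B V : Matrix (Fin d) (Fin d) ℝ) :
    frobInner (c • B) V = c * frobInner B V := by
  simp [frobInner]

lemma frobInner_sub_left (B C V : Matrix (Fin d) (Fin d) ℝ) :
    frobInner (B - C) V = frobInner B V - frobInner C V := by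
  simp [frobInner, Matrix.sub_mul]

lemma frobInner_sum_left {ι : Type*} (S : Finset ι) (B : ι → Matrix (Fin d) (Fin d) ℝ)
    (V : Matrix (Fin d) (Fin d) ℝ) :
    frobInner (∑ i ∈ S, B i) V = ∑ i ∈ S, frobInner (B i) V := by
  simp [frobInner, Matrix.transpose_sum, Matrix.sum_mul, Matrix.trace_sum]

lemma frobInner_transpose_right (B V : Matrix (Fin d) (Fin d) ℝ) :
    frobInner B Vᵀ = frobInner Bᵀ V := by
  rw [frobInner, frobInner, ← Matrix.trace_transpose, Matrix.transpose_mul,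
    Matrix.transpose_transpose, Matrix.transpose_transpose, Matrix.trace_mul_comm]

/-- The mean of `sgn (N⟨A, U⟩ + c) ⟨A, W⟩`: the part of `W` orthogonal to `U` gives a form that is
independent of the sign. -/
lemma IsIIDGOE.integral_sgn_mul (h : IsIIDGOE μ A) {U : Matrix (Fin d) (Fin d) ℝ}
    (hU : U.IsSymm) (hU1 : frobInner U U = 1) {N : ℝ} (hN : 0 < N) (i : Fin m)
    (W : Matrix (Fin d) (Fin d) ℝ) (c : ℝ) :
    ∫ ω, sgn (N * frobInner (A ω i) U + c) * frobInner (A ω i) W ∂μ =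
      √(2 / Real.pi) * Real.exp (-(c / N) ^ 2 / 2) * frobInner U W := by
  have := h.indep.isProbabilityMeasure
  set ρ := frobInner U W with hρ
  set W' := W - ρ • U with hW'
  have hg := h.hasLaw_unit hU hU1 i
  have hjoint := h.hasGaussianLaw_frobInner i U W'
  have hcov : cov[fun ω => frobInner (A ω i) U, fun ω => frobInner (A ω i) W'; μ] = 0 := by
    rw [h.covariance_frobInner, frobInner_transpose_right, hU.eq, hW', frobInner_sub_right,
      frobInner_smul_right, hU1]
    ring
  have hind := hjoint.indepFun_of_covariance_eq_zero hcov
  have hmeas : Measurable fun x : ℝ => sgn (N * x + c) := measurable_sgn.comp (by fun_prop)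
  have hsplit : ∀ ω, sgn (N * frobInner (A ω i) U + c) * frobInner (A ω i) W =
      ρ * (sgn (N * frobInner (A ω i) U + c) * frobInner (A ω i) U) +
        sgn (N * frobInner (A ω i) U + c) * frobInner (A ω i) W' := by
    intro ω
    rw [hW', frobInner_sub_right, frobInner_smul_right]
    ring
  have hb : ∀ {f : Ω → ℝ}, Integrable f μ →
      Integrable (fun ω => sgn (N * frobInner (A ω i) U + c) * f ω) μ := fun hf => by
    refine hf.bdd_mul (c := 1) (hmeas.comp_aemeasurable hg.aemeasurable).aestronglyMeasurable
      (Filter.Eventually.of_forall fun ω => ?_)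
    rw [Real.norm_eq_abs]
    exact (abs_sgn _).le
  have hi1 := hb hjoint.fst.integrable
  have hi2 := hb hjoint.snd.integrable
  simp_rw [hsplit]
  rw [integral_add (hi1.const_mul ρ) hi2, integral_const_mul]
  have h2 : ∫ ω, sgn (N * frobInner (A ω i) U + c) * frobInner (A ω i) W' ∂μ = 0 := by
    rw [hind.integral_fun_comp_mul_comp (f := fun x => sgn (N * x + c)) (g := fun x => x)
      hjoint.fst.aemeasurable hjoint.snd.aemeasurable hmeas.aestronglyMeasurable
      measurable_id.aestronglyMeasurable, h.integral_frobInner, mul_zero]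
  have h1 : ∫ ω, sgn (N * frobInner (A ω i) U + c) * frobInner (A ω i) U ∂μ =
      √(2 / Real.pi) * Real.exp (-(c / N) ^ 2 / 2) := by
    have hm' : Measurable fun x : ℝ => sgn (x + c / N) * x :=
      (measurable_sgn.comp (measurable_id.add_const _)).mul measurable_id
    rw [← integral_sgn_add_mul_gaussianReal, ← hg.map_eq, integral_map hg.aemeasurable
      hm'.aestronglyMeasurable]
    congr 1
    ext ω
    rw [← sgn_mul_of_pos hN (_ + c / N), mul_add, mul_div_cancel₀ _ hN.ne']
  rw [h1, h2]
  ring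

end

section

/-! ### Concentration of the spectral matrix and of the empirical cdf -/

variable {Ω : Type*} [MeasurableSpace Ω] {μ : Measure Ω} {d m : ℕ}
  {A : Ω → Fin m → Matrix (Fin d) (Fin d) ℝ} {s : Ω → Fin m → ℝ}

/-- Union bound over the pairs of points of a net. -/
lemma measureReal_biUnion_product_le {ι : Type*} {S : Finset ι} (hS : S.card ≤ 5 ^ d)
    {E : ι × ι → Set Ω} {δ : ℝ} (hδ : 0 ≤ δ) (hE : ∀ x ∈ S ×ˢ S, μ.real (E x) ≤ δ) :
    μ.real (⋃ x ∈ S ×ˢ S, E x) ≤ 25 ^ d * δ := by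
  refine (measureReal_biUnion_finset_le _ _).trans
    ((Finset.sum_le_card_nsmul _ _ _ hE).trans ?_)
  rw [nsmul_eq_mul, Finset.card_product]
  gcongr
  rw [show (25 : ℝ) = 5 * 5 by norm_num, mul_pow]
  exact_mod_cast Nat.mul_le_mul hS hS

/-- The sample mean of the attenuation factors of the shifts. -/
noncomputable def meanAttenuation (μ : Measure Ω) (s : Ω → Fin m → ℝ) (N : ℝ) : ℝ :=
  (1 / (m : ℝ)) * ∑ i, attenuation (μ.map fun ω => s ω i) N

/-- The average of the cdfs of `|y_i| / N`. -/
noncomputable def meanCdf (μ : Measure Ω) (s : Ω → Fin m → ℝ) (N t : ℝ) : ℝ :=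
  (1 / (m : ℝ)) * ∑ i, shiftedCdf (μ.map fun ω => s ω i) N t

namespace IsIndepModel

lemma isProbabilityMeasure (h : IsIndepModel μ A s) : IsProbabilityMeasure μ :=
  h.goe.indep.isProbabilityMeasure

lemma isProbabilityMeasure_map (h : IsIndepModel μ A s) (i : Fin m) :
    IsProbabilityMeasure (μ.map fun ω => s ω i) := by
  have := h.isProbabilityMeasure
  exact Measure.isProbabilityMeasure_map (h.aemeasurable i)

variable {U : Matrix (Fin d) (Fin d) ℝ} {N : ℝ}

lemma measurable_obs (U : Matrix (Fin d) (Fin d) ℝ) (N : ℝ) :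
    Measurable fun z : (TriuIdx d → ℝ) × ℝ => N * frobInner (symOfTriu z.1) U + z.2 :=
  (((measurable_frobInner_symOfTriu U).comp measurable_fst).const_mul N).add measurable_snd

lemma measurable_sgn_mul (U W : Matrix (Fin d) (Fin d) ℝ) (N : ℝ) :
    Measurable fun z : (TriuIdx d → ℝ) × ℝ =>
      sgn (N * frobInner (symOfTriu z.1) U + z.2) * frobInner (symOfTriu z.1) W :=
  (measurable_sgn.comp (measurable_obs U N)).mul
    ((measurable_frobInner_symOfTriu W).comp measurable_fst)

lemma aemeasurable_pair (h : IsIndepModel μ A s) (i : Fin m) :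
    AEMeasurable (fun ω => (triu (A ω i), s ω i)) μ :=
  (h.goe.aemeasurable_triu i).prodMk (h.aemeasurable i)

lemma aemeasurable_sgn_mul (h : IsIndepModel μ A s) (U W : Matrix (Fin d) (Fin d) ℝ) (N : ℝ)
    (i : Fin m) :
    AEMeasurable (fun ω => sgn (N * frobInner (A ω i) U + s ω i) * frobInner (A ω i) W) μ := by
  have := (measurable_sgn_mul U W N).comp_aemeasurable (h.aemeasurable_pair i)
  simpa only [Function.comp_def, symOfTriu_triu (h.goe.symm _ i)] using this

lemma abs_sgn_mul (x y : ℝ) : |sgn x * y| ≤ |y| := by rw [abs_mul, abs_sgn, one_mul]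

lemma integral_sgn_mul (h : IsIndepModel μ A s) (hU : U.IsSymm) (hU1 : frobInner U U = 1)
    (hN : 0 < N) (i : Fin m) (W : Matrix (Fin d) (Fin d) ℝ) :
    ∫ ω, sgn (N * frobInner (A ω i) U + s ω i) * frobInner (A ω i) W ∂μ =
      √(2 / Real.pi) * attenuation (μ.map fun ω => s ω i) N * frobInner U W := by
  have := h.isProbabilityMeasure
  have hint : Integrable
      (fun ω => sgn (N * frobInner (A ω i) U + s ω i) * frobInner (A ω i) W) μ :=
    integrable_of_abs_le_gaussian (h.goe.hasLaw_frobInner i W) (h.aemeasurable_sgn_mul U W N i)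
      fun ω => abs_sgn_mul _ _
  have key := integral_eq_of_indepFun (h.goe.aemeasurable_triu i) (h.aemeasurable i) (h.indep i)
    (measurable_sgn_mul U W N) (by simpa only [symOfTriu_triu (h.goe.symm _ i)] using hint)
  simp only [symOfTriu_triu (h.goe.symm _ i), h.goe.integral_sgn_mul hU hU1 hN i W] at key
  rw [key, integral_mul_const, integral_const_mul, attenuation,
    integral_map (h.aemeasurable i) (by fun_prop)]

lemma measureReal_abs_le (h : IsIndepModel μ A s) (hU : U.IsSymm) (hU1 : frobInner U U = 1)
    (i : Fin m) (t : ℝ) :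
    μ.real {ω | |N * frobInner (A ω i) U + s ω i| ≤ t * N} =
      shiftedCdf (μ.map fun ω => s ω i) N t := by
  have := h.isProbabilityMeasure
  have hg := h.goe.hasLaw_unit hU hU1 i
  have hind : IndepFun (fun ω => frobInner (A ω i) U) (fun ω => s ω i) μ := by
    have := (h.indep i).comp (measurable_frobInner_symOfTriu U) measurable_id
    simpa only [Function.comp_def, symOfTriu_triu (h.goe.symm _ i), id_eq] using this
  have hmap := (indepFun_iff_map_prod_eq_prod_map_map hg.aemeasurable (h.aemeasurable i)).1 hind
  rw [shiftedCdf, ← hg.map_eq, ← hmap, measureReal_def, measureReal_def,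
    Measure.map_apply_of_aemeasurable (hg.aemeasurable.prodMk (h.aemeasurable i))
      (measurableSet_abs_add_le N t)]
  rfl

/-- Concentration of one linear form of the spectral matrix. -/
lemma measureReal_abs_frobInner_ge_le (h : IsIndepModel μ A s) (hU : U.IsSymm)
    (hU1 : frobInner U U = 1) (hN : 0 < N) (hm : 0 < m) {W : Matrix (Fin d) (Fin d) ℝ}
    (hW : ((frobInner W W + frobInner W Wᵀ) / 2).toNNReal ≤ 1) {t : ℝ} (ht : 0 ≤ t) :
    μ.real {ω | t ≤ |frobInner (spectralMatrix (A ω) (fun i => N * frobInner (A ω i) U + s ω i) -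
        (√(2 / Real.pi) * meanAttenuation μ s N) • U) W|} ≤
      2 * Real.exp (-(m * t ^ 2 / (2 * proxy))) := by
  have := h.isProbabilityMeasure
  have hm' : (0 : ℝ) < m := by exact_mod_cast hm
  set Z : Fin m → Ω → ℝ := fun i ω =>
    sgn (N * frobInner (A ω i) U + s ω i) * frobInner (A ω i) W with hZ
  have hsub : ∀ i, HasSubgaussianMGF (fun ω => Z i ω - ∫ ω, Z i ω ∂μ) proxy μ := fun i =>
    hasSubgaussianMGF_of_abs_le_gaussian hW (h.goe.hasLaw_frobInner i W)
      (h.aemeasurable_sgn_mul U W N i) fun ω => abs_sgn_mul _ _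
  have hind : iIndepFun (fun i ω => Z i ω - ∫ ω, Z i ω ∂μ) μ := by
    have := h.iindep.comp (fun i z => sgn (N * frobInner (symOfTriu z.1) U + z.2) *
      frobInner (symOfTriu z.1) W - ∫ ω, Z i ω ∂μ)
      fun i => (measurable_sgn_mul U W N).sub_const _
    simpa only [Function.comp_def, symOfTriu_triu (h.goe.symm _ _)] using this
  have key := measureReal_abs_sum_ge_le hind hsub Finset.univ ht
  refine (le_of_eq ?_).trans key
  congr 1
  ext ω
  have e : frobInner (spectralMatrix (A ω) (fun i => N * frobInner (A ω i) U + s ω i) -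
      (√(2 / Real.pi) * meanAttenuation μ s N) • U) W =
        (1 / (m : ℝ)) * ∑ i, (Z i ω - ∫ ω, Z i ω ∂μ) := by
    rw [frobInner_sub_left, spectralMatrix, frobInner_smul_left, frobInner_smul_left,
      frobInner_sum_left, Finset.sum_sub_distrib, mul_sub, meanAttenuation]
    congr 1
    · simp only [frobInner_smul_left, hZ]
    · simp only [hZ, h.integral_sgn_mul hU hU1 hN _ W]
      rw [← Finset.sum_mul, ← Finset.mul_sum]
      ring
  change t ≤ _ ↔ (m : ℝ) * t ≤ _
  rw [e, abs_mul, abs_of_pos (by positivity : 0 < 1 / (m : ℝ)), one_div, ← div_eq_inv_mul,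
    le_div_iff₀ hm', mul_comm]

/-- Concentration of the spectral matrix around a multiple of the signal direction `U`. -/
lemma measureReal_norm_gt_le (h : IsIndepModel μ A s) (hU : U.IsSymm)
    (hU1 : frobInner U U = 1) (hN : 0 < N) (hm : 0 < m) {t : ℝ} (ht : 0 ≤ t) :
    μ.real {ω | 4 * t < ‖spectralMatrix (A ω) (fun i => N * frobInner (A ω i) U + s ω i) -
        (√(2 / Real.pi) * meanAttenuation μ s N) • U‖} ≤
      25 ^ d * (2 * Real.exp (-(m * t ^ 2 / (2 * proxy)))) := by
  have := h.isProbabilityMeasure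
  obtain ⟨S, hcard, hS1, hS⟩ := exists_half_net d
  set E : EuclideanSpace ℝ (Fin d) × EuclideanSpace ℝ (Fin d) → Set Ω := fun x =>
    {ω | t ≤ |frobInner (spectralMatrix (A ω) (fun i => N * frobInner (A ω i) U + s ω i) -
        (√(2 / Real.pi) * meanAttenuation μ s N) • U) (Matrix.vecMulVec x.2 x.1)|} with hE
  have hE1 : ∀ x ∈ S ×ˢ S, μ.real (E x) ≤ 2 * Real.exp (-(m * t ^ 2 / (2 * proxy))) := by
    intro x hx
    rw [Finset.mem_product] at hx
    exact h.measureReal_abs_frobInner_ge_le hU hU1 hN hm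
      (frobInner_vecMulVec_le_one (hS1 _ hx.1) (hS1 _ hx.2)) ht
  calc _ ≤ μ.real (⋃ x ∈ S ×ˢ S, E x) := by
        refine measureReal_mono (fun ω hω => ?_) (measure_ne_top _ _)
        by_contra hcon
        simp only [Set.mem_iUnion, not_exists, Finset.mem_product, hE, Set.mem_ofPred_eq,
          not_le] at hcon
        exact absurd (norm_le_of_half_net hS _ ht fun u hu v hv =>
          (hcon (u, v) ⟨hu, hv⟩).le) (not_le.2 hω)
    _ ≤ _ := measureReal_biUnion_product_le hcard (by positivity) hE1

/-- Concentration of the empirical cdf at one point (Hoeffding). -/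
lemma measureReal_empirical_ge_le (h : IsIndepModel μ A s) (hU : U.IsSymm)
    (hU1 : frobInner U U = 1) (hm : 0 < m) (τ : ℝ) {t : ℝ} (ht : 0 ≤ t) :
    μ.real {ω | t ≤ |(1 / (m : ℝ)) * ((Finset.univ.filter fun i =>
        |N * frobInner (A ω i) U + s ω i| ≤ τ * N).card : ℝ) - meanCdf μ s N τ|} ≤
      2 * Real.exp (-(m * t ^ 2 / (2 * proxy))) := by
  have := h.isProbabilityMeasure
  have hm' : (0 : ℝ) < m := by exact_mod_cast hm
  set B : Set ((TriuIdx d → ℝ) × ℝ) := {z | |N * frobInner (symOfTriu z.1) U + z.2| ≤ τ * N} with hB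
  have hBm : MeasurableSet B := measurableSet_le (measurable_obs U N).abs measurable_const
  have hBi : Measurable (B.indicator (1 : (TriuIdx d → ℝ) × ℝ → ℝ)) :=
    measurable_const.indicator hBm
  have hmem : ∀ i ω, (triu (A ω i), s ω i) ∈ B ↔ |N * frobInner (A ω i) U + s ω i| ≤ τ * N := by
    intro i ω
    simp [hB, symOfTriu_triu (h.goe.symm ω i)]
  set Z : Fin m → Ω → ℝ := fun i ω => B.indicator 1 (triu (A ω i), s ω i) with hZ
  have hZm : ∀ i, AEMeasurable (Z i) μ := fun i => hBi.comp_aemeasurable (h.aemeasurable_pair i)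
  have hsub : ∀ i, HasSubgaussianMGF (fun ω => Z i ω - ∫ ω, Z i ω ∂μ) proxy μ := fun i => by
    refine (hasSubgaussianMGF_of_mem_Icc (a := 0) (b := 1) (hZm i)
      (Filter.Eventually.of_forall fun ω => ?_)).mono ?_
    · by_cases hω : (triu (A ω i), s ω i) ∈ B <;> simp [hZ, hω]
    · have h1 : (1 : ℝ) ≤ proxy := by
        rw [coe_proxy]
        linarith [Real.add_one_le_exp (10 : ℝ)]
      rw [← NNReal.coe_le_coe]
      refine le_trans ?_ h1
      norm_num
  have hind : iIndepFun (fun i ω => Z i ω - ∫ ω, Z i ω ∂μ) μ :=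
    h.iindep.comp (fun i z => B.indicator 1 z - ∫ ω, Z i ω ∂μ) fun i => hBi.sub_const _
  have hmean : ∀ i, ∫ ω, Z i ω ∂μ = shiftedCdf (μ.map fun ω => s ω i) N τ := by
    intro i
    rw [← h.measureReal_abs_le hU hU1 i τ]
    have e : ∫ ω, Z i ω ∂μ = ∫ z, B.indicator (1 : (TriuIdx d → ℝ) × ℝ → ℝ) z
        ∂(μ.map fun ω => (triu (A ω i), s ω i)) := by
      rw [integral_map (h.aemeasurable_pair i) hBi.aestronglyMeasurable]
    rw [e, integral_indicator_one hBm, measureReal_def, measureReal_def,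
      Measure.map_apply_of_aemeasurable (h.aemeasurable_pair i) hBm]
    congr 2
    ext ω
    exact hmem i ω
  have key := measureReal_abs_sum_ge_le hind hsub Finset.univ ht
  refine (le_of_eq ?_).trans key
  congr 1
  ext ω
  have e : (1 / (m : ℝ)) * ((Finset.univ.filter fun i =>
        |N * frobInner (A ω i) U + s ω i| ≤ τ * N).card : ℝ) - meanCdf μ s N τ =
        (1 / (m : ℝ)) * ∑ i, (Z i ω - ∫ ω, Z i ω ∂μ) := by
    rw [Finset.sum_sub_distrib, mul_sub, meanCdf]
    simp only [hmean]
    congr 2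
    rw [Finset.card_filter]
    push_cast
    refine Finset.sum_congr rfl fun i _ => ?_
    by_cases hω : (triu (A ω i), s ω i) ∈ B
    · simp only [hZ, Set.indicator_of_mem hω, (hmem i ω).1 hω, if_true, Pi.one_apply]
    · have := mt (hmem i ω).2 hω
      simp only [hZ, Set.indicator_of_notMem hω, this, if_false]
  change t ≤ _ ↔ (m : ℝ) * t ≤ _
  rw [e, abs_mul, abs_of_pos (by positivity : 0 < 1 / (m : ℝ)), one_div, ← div_eq_inv_mul,
    le_div_iff₀ hm', mul_comm]

end IsIndepModel

end

section

/-! ### Medians and thresholds -/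

lemma IsSampleMedian.mem_Icc {m : ℕ} {x : Fin m → ℝ} {ξ lo hi : ℝ} (h : IsSampleMedian x ξ)
    (hlo : 2 * (Finset.univ.filter fun i => x i ≤ lo).card < m)
    (hhi : m < 2 * (Finset.univ.filter fun i => x i ≤ hi).card) : ξ ∈ Set.Icc lo hi := by
  constructor
  · by_contra! hlt
    have : (Finset.univ.filter fun i => x i ≤ ξ).card ≤
        (Finset.univ.filter fun i => x i ≤ lo).card :=
      Finset.card_le_card fun i hi => by
        simp only [Finset.mem_filter, Finset.mem_univ, true_and] at hi ⊢
        linarith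
    have := h.1
    omega
  · by_contra! hlt
    have h1 : (Finset.univ.filter fun i => ξ ≤ x i).card ≤
        (Finset.univ.filter fun i => ¬ x i ≤ hi).card :=
      Finset.card_le_card fun i hi => by
        simp only [Finset.mem_filter, Finset.mem_univ, true_and, not_le] at hi ⊢
        linarith
    have h2 := Finset.card_filter_add_card_filter_not (s := (Finset.univ : Finset (Fin m)))
      (fun i => x i ≤ hi)
    rw [Finset.card_univ, Fintype.card_fin] at h2
    have := h.2
    omega

/-- The population median `τ` of a corrupted sample: it crosses level `1/2` of the mean cdf `F`,
and it is controlled by folded normal quantiles, also after multiplication by the attenuation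
`ψ`. Concavity of the folded normal cdf gives the bound on `ψ τ`. -/
lemma exists_threshold {F : ℝ → ℝ} {p ψ : ℝ} (hp0 : 0 < p) (hp : p < 1 / 2)
    (hψ : 1 - p ≤ ψ) (hF1 : ∀ t, ψ * cdf foldedNormal t ≤ F t)
    (hF2 : ∀ t, F t ≤ (1 - p) * cdf foldedNormal t + p) :
    ∃ τ, foldedNormalQuantile ((1 / 2 - p) / 3) ≤ τ ∧
      τ ≤ foldedNormalQuantile (1 - (1 / 2 - p) / 3) ∧
      ψ * τ ≤ 3 / 5 * foldedNormalQuantile (1 - (1 / 2 - p) / 3) ∧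
      (∀ t, 0 ≤ t → t < τ → F t < 1 / 2) ∧ (∀ t, τ < t → ∃ u, 0 ≤ u ∧ u < t ∧ 1 / 2 ≤ F u) := by
  set δ := 1 / 2 - p with hδ
  have hδ0 : 0 < δ := by rw [hδ]; linarith
  have hδ1 : δ < 1 / 2 := by rw [hδ]; linarith
  obtain ⟨hT0, hT⟩ := foldedNormalQuantile_spec (ε := 1 - δ / 3) (by linarith) (by linarith)
  set T := foldedNormalQuantile (1 - δ / 3) with hTdef
  set S := {t : ℝ | 0 ≤ t ∧ 1 / 2 ≤ F t} with hS
  have hTS : T ∈ S := by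
    refine ⟨hT0.le, le_trans ?_ (hF1 T)⟩
    rw [hT]
    have : (1 - p) * (1 - δ / 3) ≤ ψ * (1 - δ / 3) := by
      apply mul_le_mul_of_nonneg_right hψ
      linarith
    refine le_trans ?_ this
    have : 1 - p = 1 / 2 + δ := by rw [hδ]; ring
    rw [this]
    nlinarith
  have hbdd : BddBelow S := ⟨0, fun t ht => ht.1⟩
  have hlow : foldedNormalQuantile (δ / 3) ≤ sInf S := by
    refine le_csInf ⟨T, hTS⟩ fun t ht => ?_
    refine foldedNormalQuantile_le (by linarith) (by linarith) ht.1 ?_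
    have h1 := ht.2.trans (hF2 t)
    have h2 := cdf_nonneg foldedNormal t
    nlinarith
  have hbelow : ∀ t, 0 ≤ t → t < sInf S → F t < 1 / 2 := by
    intro t ht htS
    by_contra! hcon
    exact absurd (csInf_le hbdd (show t ∈ S from ⟨ht, hcon⟩)) (not_le.2 htS)
  have hψ0 : 0 < ψ := by linarith
  refine ⟨sInf S, hlow, csInf_le hbdd hTS, ?_, hbelow, fun t ht => ?_⟩
  · have hq0 := (foldedNormalQuantile_spec (ε := δ / 3) (by linarith) (by linarith)).1
    rw [mul_comm, ← le_div_iff₀ hψ0]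
    refine le_of_forall_lt fun c hc => ?_
    by_contra! hcon
    have hc0 : 0 ≤ c := le_trans (by positivity) hcon
    -- a point `c'` slightly below the infimum would violate the bound on `ψ c'`, which follows
    -- from `ψ G(c') < 1/2` and `c' G(T) ≤ T G(c')`, where `G` is the folded normal cdf
    obtain ⟨c', hcc', hc'⟩ := exists_between hc
    have h1 := (hF1 c').trans_lt (hbelow c' (hc0.trans hcc'.le) hc')
    have h2 := mul_cdf_foldedNormal_le (hc0.trans hcc'.le) (hc'.le.trans (csInf_le hbdd hTS))
    rw [hT] at h2
    have h3 : 3 / 5 * T < c' * ψ := by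
      rw [div_le_iff₀ hψ0] at hcon
      exact hcon.trans_lt (mul_lt_mul_of_pos_right hcc' hψ0)
    have h4 : c' * (1 - δ / 3) * ψ ≤ T * (1 / 2) := by
      calc c' * (1 - δ / 3) * ψ ≤ T * cdf foldedNormal c' * ψ :=
            mul_le_mul_of_nonneg_right h2 hψ0.le
        _ = T * (ψ * cdf foldedNormal c') := by ring
        _ ≤ T * (1 / 2) := mul_le_mul_of_nonneg_left h1.le hT0.le
    have h5 : c' * ψ * (5 / 6) ≤ c' * (1 - δ / 3) * ψ := by
      have : 0 ≤ c' * ψ := mul_nonneg (hc0.trans hcc'.le) hψ0.le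
      nlinarith
    nlinarith
  · obtain ⟨u, hu, hut⟩ := exists_lt_of_csInf_lt ⟨T, hTS⟩ ht
    exact ⟨u, hu.1, hut, hu.2⟩

variable {Ω : Type*} [MeasurableSpace Ω] {μ : Measure Ω} {d m : ℕ}
  {A : Ω → Fin m → Matrix (Fin d) (Fin d) ℝ} {s : Ω → Fin m → ℝ} {N : ℝ}

/-! ### Averages over the sample -/

lemma average_le {m : ℕ} (hm : 0 < m) {f : Fin m → ℝ} {c : ℝ} (h : ∀ i, f i ≤ c) :
    (1 / (m : ℝ)) * ∑ i, f i ≤ c := by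
  have hm' : (0 : ℝ) < m := by exact_mod_cast hm
  have := Finset.sum_le_card_nsmul Finset.univ f c fun i _ => h i
  rw [Finset.card_univ, Fintype.card_fin, nsmul_eq_mul] at this
  rw [one_div, ← div_eq_inv_mul, div_le_iff₀ hm']
  linarith

lemma le_average {m : ℕ} (hm : 0 < m) {f : Fin m → ℝ} {c : ℝ} (h : ∀ i, c ≤ f i) :
    c ≤ (1 / (m : ℝ)) * ∑ i, f i := by
  have := average_le hm (f := fun i => -f i) (c := -c) fun i => neg_le_neg (h i)
  rw [Finset.sum_neg_distrib, mul_neg] at this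
  linarith

namespace IsIndepModel

lemma meanAttenuation_le_one (h : IsIndepModel μ A s) (hm : 0 < m) :
    meanAttenuation μ s N ≤ 1 :=
  average_le hm fun i => by
    have := h.isProbabilityMeasure_map i
    exact attenuation_le_one

lemma le_meanAttenuation (h : IsIndepModel μ A s) (hm : 0 < m) {β : ℝ}
    (hβ : ∀ i, β ≤ (μ.map fun ω => s ω i).real {0}) : β ≤ meanAttenuation μ s N :=
  le_average hm fun i => by
    have := h.isProbabilityMeasure_map i
    exact (hβ i).trans measureReal_zero_le_attenuation

lemma meanAttenuation_mul_cdf_le (h : IsIndepModel μ A s) (hN : 0 < N) (t : ℝ) :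
    meanAttenuation μ s N * cdf foldedNormal t ≤ meanCdf μ s N t := by
  rw [meanAttenuation, meanCdf, mul_assoc, Finset.sum_mul]
  gcongr with i
  have := h.isProbabilityMeasure_map i
  exact attenuation_mul_cdf_le hN t

lemma meanCdf_le (h : IsIndepModel μ A s) (hN : 0 < N) (hm : 0 < m) {p : ℝ}
    (hp : ∀ i, (μ.map fun ω => s ω i).real {0} = 1 - p) (t : ℝ) :
    meanCdf μ s N t ≤ (1 - p) * cdf foldedNormal t + p :=
  average_le hm fun i => by
    have := h.isProbabilityMeasure_map i
    have := shiftedCdf_le (σ := μ.map fun ω => s ω i) hN t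
    rw [hp i] at this
    linarith

lemma mul_sub_le_meanCdf_sub (h : IsIndepModel μ A s) (hN : 0 < N) (hm : 0 < m) {β : ℝ}
    (hβ : ∀ i, β ≤ (μ.map fun ω => s ω i).real {0}) {a b : ℝ} (hab : a ≤ b) :
    β * (cdf foldedNormal b - cdf foldedNormal a) ≤ meanCdf μ s N b - meanCdf μ s N a := by
  rw [meanCdf, meanCdf, ← mul_sub, ← Finset.sum_sub_distrib]
  refine le_average hm fun i => ?_
  have := h.isProbabilityMeasure_map i
  refine le_trans ?_ (mul_sub_le_shiftedCdf_sub hN hab)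
  exact mul_le_mul_of_nonneg_right (hβ i) (sub_nonneg.2 (monotone_cdf _ hab))

/-- Around its threshold `τ`, the mean cdf grows at least linearly. -/
lemma meanCdf_gap (h : IsIndepModel μ A s) (hN : 0 < N) (hm : 0 < m) {β : ℝ} (hβ0 : 0 ≤ β)
    (hβ : ∀ i, β ≤ (μ.map fun ω => s ω i).real {0}) {τ η T : ℝ} (hη0 : 0 < η) (hη1 : η ≤ 1)
    (hητ : η ≤ τ) (hτT : τ ≤ T)
    (hlow : ∀ t, 0 ≤ t → t < τ → meanCdf μ s N t < 1 / 2)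
    (hup : ∀ t, τ < t → ∃ u, 0 ≤ u ∧ u < t ∧ 1 / 2 ≤ meanCdf μ s N u) :
    meanCdf μ s N (τ - η) ≤ 1 / 2 - β * gaussianPDFReal 0 1 (T + 1) * η ∧
      1 / 2 + β * gaussianPDFReal 0 1 (T + 1) * η ≤ meanCdf μ s N (τ + η) := by
  have hφ := gaussianPDFReal_nonneg 0 1 (T + 1)
  have step : ∀ a b, 0 ≤ a → a + η / 2 ≤ b → b ≤ T + 1 →
      β * gaussianPDFReal 0 1 (T + 1) * η ≤ meanCdf μ s N b - meanCdf μ s N a := by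
    intro a b ha hab hb
    have hab' : a ≤ b := by linarith
    have h1 := mul_sub_le_cdf_foldedNormal_sub ha hab'
    have h2 := h.mul_sub_le_meanCdf_sub hN hm hβ hab'
    have h3 : gaussianPDFReal 0 1 (T + 1) ≤ gaussianPDFReal 0 1 b :=
      gaussianPDFReal_anti (ha.trans hab') hb
    refine le_trans ?_ h2
    rw [mul_assoc]
    refine mul_le_mul_of_nonneg_left (le_trans ?_ h1) hβ0
    calc gaussianPDFReal 0 1 (T + 1) * η = 2 * gaussianPDFReal 0 1 (T + 1) * (η / 2) := by ring
      _ ≤ 2 * gaussianPDFReal 0 1 b * (b - a) := by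
        have : η / 2 ≤ b - a := by linarith
        exact mul_le_mul (by linarith) this (by linarith) (by linarith)
  constructor
  · have h1 := hlow (τ - η / 2) (by linarith) (by linarith)
    have h2 := step (τ - η) (τ - η / 2) (by linarith) (by linarith) (by linarith)
    linarith
  · obtain ⟨u, hu0, hu, hu2⟩ := hup (τ + η / 2) (by linarith)
    have h2 := step u (τ + η) hu0 (by linarith) (by linarith)
    linarith

/-- The event on which the uncorrupted part of the argument works has overwhelming probability:
the spectral matrix is near its mean, and the empirical cdf is separated from `1/2` on both sides
of the threshold. -/
lemma measureReal_not_good_le (h : IsIndepModel μ A s) {U : Matrix (Fin d) (Fin d) ℝ}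
    (hU : U.IsSymm) (hU1 : frobInner U U = 1) (hN : 0 < N) (hm : 0 < m) {a ε lo hi : ℝ}
    (ha : 0 ≤ a) (hε : 0 ≤ ε) (hlo : meanCdf μ s N lo ≤ 1 / 2 - 2 * ε)
    (hhi : 1 / 2 + 2 * ε ≤ meanCdf μ s N hi) :
    μ.real {ω | ¬ (‖spectralMatrix (A ω) (fun i => N * frobInner (A ω i) U + s ω i) -
        (√(2 / Real.pi) * meanAttenuation μ s N) • U‖ ≤ 4 * a ∧
      ((Finset.univ.filter fun i => |N * frobInner (A ω i) U + s ω i| ≤ lo * N).card : ℝ) <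
        m * (1 / 2 - ε) ∧
      m * (1 / 2 + ε) <
        ((Finset.univ.filter fun i => |N * frobInner (A ω i) U + s ω i| ≤ hi * N).card : ℝ))} ≤
      25 ^ d * (2 * Real.exp (-(m * a ^ 2 / (2 * proxy)))) +
        4 * Real.exp (-(m * ε ^ 2 / (2 * proxy))) := by
  have := h.isProbabilityMeasure
  have hm' : (0 : ℝ) < m := by exact_mod_cast hm
  have h1 := h.measureReal_norm_gt_le hU hU1 hN hm ha
  have h2 := h.measureReal_empirical_ge_le (N := N) hU hU1 hm lo hε
  have h3 := h.measureReal_empirical_ge_le (N := N) hU hU1 hm hi hε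
  set E1 : Set Ω := {ω | 4 * a < ‖spectralMatrix (A ω)
    (fun i => N * frobInner (A ω i) U + s ω i) - (√(2 / Real.pi) * meanAttenuation μ s N) • U‖}
  set E2 : Set Ω := {ω | ε ≤ |(1 / (m : ℝ)) * ((Finset.univ.filter fun i =>
        |N * frobInner (A ω i) U + s ω i| ≤ lo * N).card : ℝ) - meanCdf μ s N lo|} with hE2
  set E3 : Set Ω := {ω | ε ≤ |(1 / (m : ℝ)) * ((Finset.univ.filter fun i =>
        |N * frobInner (A ω i) U + s ω i| ≤ hi * N).card : ℝ) - meanCdf μ s N hi|} with hE3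
  have hsub : {ω | ¬ (‖spectralMatrix (A ω) (fun i => N * frobInner (A ω i) U + s ω i) -
        (√(2 / Real.pi) * meanAttenuation μ s N) • U‖ ≤ 4 * a ∧
      ((Finset.univ.filter fun i => |N * frobInner (A ω i) U + s ω i| ≤ lo * N).card : ℝ) <
        m * (1 / 2 - ε) ∧
      m * (1 / 2 + ε) <
        ((Finset.univ.filter fun i => |N * frobInner (A ω i) U + s ω i| ≤ hi * N).card : ℝ))} ⊆
      E1 ∪ (E2 ∪ E3) := by
    intro ω hω
    by_contra hcon
    simp only [Set.mem_union, not_or] at hcon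
    obtain ⟨c1, c2, c3⟩ := hcon
    refine hω ⟨not_lt.1 c1, ?_, ?_⟩
    · rw [hE2, Set.mem_ofPred_eq, not_le, one_div, ← div_eq_inv_mul, abs_lt] at c2
      have := c2.2
      rw [mul_comm (m : ℝ), ← div_lt_iff₀ hm']
      linarith
    · rw [hE3, Set.mem_ofPred_eq, not_le, one_div, ← div_eq_inv_mul, abs_lt] at c3
      have := c3.1
      rw [mul_comm (m : ℝ), ← lt_div_iff₀ hm']
      linarith
  refine (measureReal_mono hsub (measure_ne_top _ _)).trans ((measureReal_union_le _ _).trans ?_)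
  have := measureReal_union_le (μ := μ) E2 E3
  linarith

end IsIndepModel

/-! ### From concentration to the spectral initialization -/

/-- Deterministic error bound for the spectral initialization, in terms of the deviation `a` of
the spectral matrix and the relative deviation `η` of the sample median. -/
lemma IsSpectralInit.norm_sub_le {k : ℕ} {hk : k ≤ d} {B : Fin m → Matrix (Fin d) (Fin d) ℝ}
    {y : Fin m → ℝ} {F : Matrix (Fin d) (Fin k) ℝ} (hF : IsSpectralInit hk B y F)
    {X U : Matrix (Fin d) (Fin d) ℝ} (hX : X.PosSemidef) (hXk : X.rank ≤ k) (hN : 0 < N)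
    (hXU : X = N • U) {a η ψ τ : ℝ} (hψ0 : 0 ≤ ψ) (hψ1 : ψ ≤ 1) (hη0 : 0 ≤ η) (hητ : η ≤ τ)
    (hD : ‖spectralMatrix B y - (√(2 / Real.pi) * ψ) • U‖ ≤ a)
    (hξ : ∀ ξ, IsSampleMedian (fun i => |y i|) ξ →
      ξ ∈ Set.Icc ((τ - η) * N) ((τ + η) * N)) :
    ‖F * Fᵀ - (ψ * (τ / foldedNormalQuantile (1 / 2))) • X‖ ≤
      2 * (2 * τ * N / (√(2 / Real.pi) * foldedNormalQuantile (1 / 2)) * a +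
        η / foldedNormalQuantile (1 / 2) * ‖X‖) := by
  obtain ⟨V, ev, ξ, hV, hev, hDV, hmed, hFdef⟩ := hF
  obtain ⟨hξ1, hξ2⟩ := hξ ξ hmed
  have hθ := (foldedNormalQuantile_spec (ε := 1 / 2) (by norm_num) (by norm_num)).1
  set θ := foldedNormalQuantile (1 / 2)
  have hw : 0 < √(2 / Real.pi) := by have := Real.pi_pos; positivity
  set w := √(2 / Real.pi)
  have hτ : 0 ≤ τ := hη0.trans hητ
  have hξ0 : 0 ≤ ξ := le_trans (mul_nonneg (by linarith) hN.le) hξ1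
  have ha : 0 ≤ a := (norm_nonneg _).trans hD
  have hV' : Vᵀ * V = 1 := (Matrix.mem_orthogonalGroup_iff' _ _).1 hV
  refine norm_truncation_sub_le hk hXk hX hV' hev hDV (γ := ξ / (w * θ)) (by positivity)
    (by positivity) ?_ hFdef
  have e : (ξ / (w * θ)) • spectralMatrix B y - (ψ * (τ / θ)) • X =
      (ξ / (w * θ)) • (spectralMatrix B y - (w * ψ) • U) + (ψ * (ξ - τ * N) / (θ * N)) • X := by
    rw [hXU, smul_sub, smul_smul, smul_smul, smul_smul, sub_add, ← sub_smul]
    congr 2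
    field_simp
    ring
  rw [e]
  refine (norm_add_le _ _).trans (add_le_add ?_ ?_)
  · rw [norm_smul, Real.norm_eq_abs, abs_of_nonneg (by positivity)]
    gcongr
    nlinarith
  · rw [norm_smul, Real.norm_eq_abs, abs_div, abs_mul, abs_of_nonneg hψ0,
      abs_of_pos (by positivity : 0 < θ * N)]
    refine mul_le_mul_of_nonneg_right ?_ (norm_nonneg _)
    rw [div_le_div_iff₀ (by positivity) hθ]
    have h1 : |ξ - τ * N| ≤ η * N := abs_le.2 ⟨by linarith, by linarith⟩
    calc ψ * |ξ - τ * N| * θ ≤ 1 * (η * N) * θ := by gcongr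
      _ = η * (θ * N) := by ring

end

section

/-! ### The effect of arbitrary corruption -/

variable {Ω : Type*} [MeasurableSpace Ω] {μ : Measure Ω} {d m : ℕ}
  {A : Ω → Fin m → Matrix (Fin d) (Fin d) ℝ} {s : Ω → Fin m → ℝ}

/-- Changing the observations with index in `T` moves a linear form of the spectral matrix by at
most twice the absolute values of the linear forms with index in `T`. -/
lemma abs_frobInner_spectralMatrix_sub_le (B : Fin m → Matrix (Fin d) (Fin d) ℝ)
    {y y' : Fin m → ℝ} {T : Finset (Fin m)} (hT : ∀ i ∉ T, y i = y' i)
    (W : Matrix (Fin d) (Fin d) ℝ) :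
    |frobInner (spectralMatrix B y - spectralMatrix B y') W| ≤
      1 / m * (2 * ∑ i ∈ T, |frobInner (B i) W|) := by
  have e : frobInner (spectralMatrix B y - spectralMatrix B y') W =
      1 / m * ∑ i ∈ T, (sgn (y i) - sgn (y' i)) * frobInner (B i) W := by
    rw [spectralMatrix, spectralMatrix, ← smul_sub, ← Finset.sum_sub_distrib, frobInner_smul_left,
      frobInner_sum_left]
    congr 1
    simp only [← sub_smul, frobInner_smul_left]
    refine (Finset.sum_subset (Finset.subset_univ T) fun i _ hi => ?_).symm
    rw [hT i hi, sub_self, zero_mul]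
  rw [e, abs_mul, abs_of_nonneg (by positivity : (0 : ℝ) ≤ 1 / m)]
  refine mul_le_mul_of_nonneg_left ?_ (by positivity)
  rw [Finset.mul_sum]
  refine (Finset.abs_sum_le_sum_abs _ _).trans (Finset.sum_le_sum fun i _ => ?_)
  rw [abs_mul]
  refine mul_le_mul_of_nonneg_right ?_ (abs_nonneg _)
  have := abs_sub (sgn (y i)) (sgn (y' i))
  rw [abs_sgn, abs_sgn] at this
  linarith

/-- For a fixed index set `T`, the sum over `T` of the absolute values of a linear form of the
`A_i` concentrates. -/
lemma IsIIDGOE.measureReal_abs_sum_abs_ge_le (h : IsIIDGOE μ A) {W : Matrix (Fin d) (Fin d) ℝ}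
    (hW : ((frobInner W W + frobInner W Wᵀ) / 2).toNNReal ≤ 1) (T : Finset (Fin m)) {t : ℝ}
    (ht : 0 ≤ t) :
    μ.real {ω | m * t ≤
        |∑ i ∈ T, (|frobInner (A ω i) W| - ∫ ω', |frobInner (A ω' i) W| ∂μ)|} ≤
      2 * Real.exp (-(m * t ^ 2 / (2 * proxy))) := by
  have := h.indep.isProbabilityMeasure
  refine measureReal_abs_sum_ge_le (c := proxy) ?_ (fun i => ?_) T ht
  · have := h.iIndepFun_triu.comp (fun i z => |frobInner (symOfTriu z) W| -
      ∫ ω', |frobInner (A ω' i) W| ∂μ)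
      fun i => (measurable_frobInner_symOfTriu W).abs.sub_const _
    simpa only [Function.comp_def, symOfTriu_triu (h.symm _ _)] using this
  · have hl := h.hasLaw_frobInner i W
    exact hasSubgaussianMGF_of_abs_le_gaussian hW hl
      (measurable_id.abs.comp_aemeasurable hl.aemeasurable) fun ω => (abs_abs _).le

/-- The corrupted set almost surely has at most `p m` elements. -/
lemma IsAC.ae_ncard_le [IsProbabilityMeasure μ] {p : ℝ} (hs : IsAC μ A s p) (hp : 0 ≤ p) :
    ∀ᵐ ω ∂μ, ((Function.support (s ω)).ncard : ℝ) ≤ p * m := by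
  have hset : MeasurableSet {T : Set (Fin m) | T.ncard = ⌊p * m⌋₊} := Set.Finite.measurableSet
    (Set.toFinite _)
  have h1 : ∀ᵐ T ∂(μ.map fun ω => Function.support (s ω)), T.ncard = ⌊p * m⌋₊ := by
    rw [hs.law_support.map_eq]
    exact ae_cond_mem hset
  filter_upwards [ae_of_ae_map hs.law_support.aemeasurable h1] with ω hω
  rw [hω]
  exact Nat.floor_le (by positivity)

/-- An event that is unlikely for every fixed index set is unlikely for the random, independent
corrupted set. -/
lemma IsAC.measureReal_support_le [IsProbabilityMeasure μ] {p δ : ℝ} (hs : IsAC μ A s p)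
    (G : Set (Fin m) → Set (Fin m → Fin d → Fin d → ℝ)) (hG : ∀ T, MeasurableSet (G T))
    (hδ : ∀ T, μ.real {ω | (fun i a b => A ω i a b) ∈ G T} ≤ δ) :
    μ.real {ω | (fun i a b => A ω i a b) ∈ G (Function.support (s ω))} ≤ δ := by
  classical
  have hf := hs.law_support.aemeasurable
  have hprob := Measure.isProbabilityMeasure_map hf
  set f : Ω → Set (Fin m) := fun ω => Function.support (s ω) with hf_def
  have hsub : {ω | (fun i a b => A ω i a b) ∈ G (Function.support (s ω))} ⊆
      ⋃ T ∈ (Finset.univ : Finset (Set (Fin m))),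
        {ω | (fun i a b => A ω i a b) ∈ G T} ∩ f ⁻¹' {T} := by
    intro ω hω
    simp only [Set.mem_iUnion]
    exact ⟨f ω, Finset.mem_univ _, hω, rfl⟩
  refine (measureReal_mono hsub (measure_ne_top _ _)).trans
    ((measureReal_biUnion_finset_le _ _).trans ?_)
  have h1 : ∀ T, μ.real ({ω | (fun i a b => A ω i a b) ∈ G T} ∩ f ⁻¹' {T}) ≤
      δ * (μ.map f).real {T} := by
    intro T
    have := hs.indep.measure_inter_preimage_eq_mul (G T) {T} (hG T) (measurableSet_singleton T)
    have e : (μ.map f).real {T} = μ.real (f ⁻¹' {T}) := by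
      rw [measureReal_def, measureReal_def, Measure.map_apply_of_aemeasurable hf
        (measurableSet_singleton T)]
    rw [e]
    refine le_trans (le_of_eq ?_) (mul_le_mul_of_nonneg_right (hδ T) measureReal_nonneg)
    rw [measureReal_def, measureReal_def, measureReal_def, ← ENNReal.toReal_mul]
    exact congrArg _ this
  refine (Finset.sum_le_sum fun T _ => h1 T).trans ?_
  rw [← Finset.mul_sum, sum_measureReal_singleton, Finset.coe_univ, probReal_univ, mul_one]

/-- Corrupting a `p`-fraction of the observations, at random places, moves the spectral matrix by
`O(p)`, up to the deviation `t`. -/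
lemma IsAC.measureReal_norm_sub_gt_le {p : ℝ} (h : IsIIDGOE μ A)
    (hs : IsAC μ A s p) (hp : 0 ≤ p) (hm : 0 < m) {t : ℝ} (ht : 0 ≤ t) :
    μ.real {ω | ∃ y y' : Fin m → ℝ, (∀ i, s ω i = 0 → y i = y' i) ∧
        8 * (4 * p + t) < ‖spectralMatrix (A ω) y - spectralMatrix (A ω) y'‖} ≤
      25 ^ d * (2 * Real.exp (-(m * t ^ 2 / (2 * proxy)))) := by
  classical
  have := h.indep.isProbabilityMeasure
  have hm' : (0 : ℝ) < m := by exact_mod_cast hm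
  obtain ⟨S, hcard, hS1, hS⟩ := exists_half_net d
  set e : EuclideanSpace ℝ (Fin d) × EuclideanSpace ℝ (Fin d) → Fin m → ℝ := fun x i =>
    ∫ ω', |frobInner (A ω' i) (Matrix.vecMulVec x.2 x.1)| ∂μ with he
  have he4 : ∀ x ∈ S ×ˢ S, ∀ i, e x i ≤ 4 := by
    intro x hx i
    rw [Finset.mem_product] at hx
    have hl := h.hasLaw_frobInner i (Matrix.vecMulVec x.2 x.1)
    exact integral_abs_le_four (frobInner_vecMulVec_le_one (hS1 _ hx.1) (hS1 _ hx.2)) hl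
      hl.aemeasurable fun ω => le_rfl
  set G : Set (Fin m) → Set (Fin m → Fin d → Fin d → ℝ) := fun T =>
    ⋃ x ∈ S ×ˢ S, {B | m * t ≤ |∑ i ∈ T.toFinset,
      (|frobInner (Matrix.of (B i)) (Matrix.vecMulVec x.2 x.1)| - e x i)|} with hG
  have hGm : ∀ T, MeasurableSet (G T) := by
    intro T
    refine Finset.measurableSet_biUnion _ fun x _ => measurableSet_le measurable_const ?_
    refine Measurable.abs (Finset.measurable_fun_sum _ fun i _ => ?_)
    refine Measurable.sub_const (Measurable.abs ?_) _
    simp only [frobInner_eq_sum, Matrix.of_apply]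
    fun_prop
  have hδ : ∀ T, μ.real {ω | (fun i a b => A ω i a b) ∈ G T} ≤
      25 ^ d * (2 * Real.exp (-(m * t ^ 2 / (2 * proxy)))) := by
    intro T
    have hE1 : ∀ x ∈ S ×ˢ S, μ.real {ω | m * t ≤ |∑ i ∈ T.toFinset,
        (|frobInner (A ω i) (Matrix.vecMulVec x.2 x.1)| - e x i)|} ≤
        2 * Real.exp (-(m * t ^ 2 / (2 * proxy))) := by
      intro x hx
      rw [Finset.mem_product] at hx
      exact h.measureReal_abs_sum_abs_ge_le
        (frobInner_vecMulVec_le_one (hS1 _ hx.1) (hS1 _ hx.2)) _ ht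
    refine le_trans (measureReal_mono (fun ω hω => ?_) (measure_ne_top _ _))
      (measureReal_biUnion_product_le hcard (by positivity) hE1)
    simp only [hG, Set.mem_iUnion, Set.mem_ofPred_eq] at hω ⊢
    exact hω
  refine le_trans ?_ (hs.measureReal_support_le G hGm hδ)
  have hae := hs.ae_ncard_le hp
  refine ENNReal.toReal_mono (measure_ne_top _ _) (measure_mono_ae ?_)
  filter_upwards [hae] with ω hω hbad
  obtain ⟨y, y', hyy, hbad⟩ := hbad
  by_contra hcon
  change (fun i a b => A ω i a b) ∉ G (Function.support (s ω)) at hcon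
  simp only [hG, Set.mem_iUnion, not_exists, Finset.mem_product, Set.mem_ofPred_eq,
    not_le] at hcon
  set T := (Function.support (s ω)).toFinset with hT
  have hTcard : (T.card : ℝ) ≤ p * m := by
    rw [hT, ← Set.ncard_eq_toFinset_card']
    exact hω
  refine absurd (norm_le_of_half_net hS (spectralMatrix (A ω) y - spectralMatrix (A ω) y')
    (a := 2 * (4 * p + t)) (by positivity) fun u hu v hv => ?_) (not_le.2 (by linarith))
  refine (abs_frobInner_spectralMatrix_sub_le (A ω) (T := T) (fun i hi => hyy i ?_) _).trans ?_
  · simpa [hT] using hi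
  have h1 := (abs_lt.1 (hcon (u, v) ⟨hu, hv⟩)).2
  rw [Finset.sum_sub_distrib] at h1
  have h2 : ∑ i ∈ T, e (u, v) i ≤ T.card * 4 := by
    simpa using Finset.sum_le_sum fun i (_ : i ∈ T) => he4 (u, v) (Finset.mem_product.2 ⟨hu, hv⟩) i
  have h3 : ∑ i ∈ T, |frobInner (A ω i) (Matrix.vecMulVec v u)| ≤ m * (4 * p + t) := by
    have h4 : ∑ i ∈ T, |frobInner (A ω i) (Matrix.vecMulVec v u)| < m * t + T.card * 4 := by
      have : ∑ i ∈ T, |frobInner (A ω i) (Matrix.vecMulVec v u)| - ∑ i ∈ T, e (u, v) i <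
        m * t := h1
      linarith
    nlinarith
  rw [one_div, inv_mul_le_iff₀ hm']
  linarith

end

section

/-! ### Recovery guarantees -/

variable {Ω : Type*} [MeasurableSpace Ω] {μ : Measure Ω} {d m : ℕ}
  {A : Ω → Fin m → Matrix (Fin d) (Fin d) ℝ} {s : Ω → Fin m → ℝ}

/-- The bad set need not be measurable: its measurable hull is used. -/
lemma HoldsWithProb.of_measureReal_le [IsProbabilityMeasure μ] {q δ : ℝ} {P : Ω → Prop}
    (h : μ.real {ω | ¬ P ω} ≤ δ) (hq : q ≤ 1 - δ) : HoldsWithProb μ q P := by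
  refine ⟨(toMeasurable μ {ω | ¬ P ω})ᶜ, (measurableSet_toMeasurable _ _).compl, ?_, ?_⟩
  · rw [measureReal_compl (measurableSet_toMeasurable _ _), probReal_univ, measureReal_def,
      measure_toMeasurable, ← measureReal_def]
    linarith
  · intro ω hω
    by_contra hcon
    exact hω (subset_toMeasurable _ _ hcon)

lemma HoldsWithProb.of_nonpos {q : ℝ} {P : Ω → Prop} (hq : q ≤ 0) : HoldsWithProb μ q P :=
  ⟨∅, MeasurableSet.empty, by simpa using hq, fun _ h => h.elim⟩

/-- A signal of rank `r` is a multiple `N U` of a unit symmetric matrix, with `N ≤ √r σ₁`. -/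
lemma exists_unit_direction {X : Matrix (Fin d) (Fin d) ℝ} (hX : X.PosSemidef) {r : ℕ}
    (hr : 1 ≤ r) (hrank : X.rank = r) :
    ∃ (N : ℝ) (U : Matrix (Fin d) (Fin d) ℝ), 0 < N ∧ U.IsSymm ∧ frobInner U U = 1 ∧
      X = N • U ∧ N ≤ √r * singVal X 1 := by
  have hX0 : X ≠ 0 := by
    rintro rfl
    rw [Matrix.rank_zero] at hrank
    omega
  have hpos := frobInner_self_pos hX0
  have hN : 0 < √(frobInner X X) := Real.sqrt_pos.2 hpos
  refine ⟨√(frobInner X X), (√(frobInner X X))⁻¹ • X, hN, ?_, ?_, ?_, ?_⟩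
  · have hs : X.IsSymm := by
      have := hX.isHermitian
      rwa [Matrix.IsHermitian, Matrix.conjTranspose_eq_transpose_of_trivial] at this
    exact hs.smul _
  · rw [frobInner_smul_left, frobInner_smul_right, ← mul_assoc, ← mul_inv,
      Real.mul_self_sqrt hpos.le, inv_mul_cancel₀ hpos.ne']
  · rw [smul_smul, mul_inv_cancel₀ hN.ne', one_smul]
  · rw [Real.sqrt_le_left (by have := singVal_nonneg X 1; positivity), mul_pow,
      Real.sq_sqrt (Nat.cast_nonneg r)]
    exact frobInner_self_le X hrank

lemma observations_eq {B : Fin m → Matrix (Fin d) (Fin d) ℝ} {X U : Matrix (Fin d) (Fin d) ℝ}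
    {N : ℝ} (hXU : X = N • U) (c : Fin m → ℝ) :
    observations B X c = fun i => N * frobInner (B i) U + c i := by
  funext i
  rw [observations, hXU, frobInner_smul_right]

lemma one_le_condNumber {X : Matrix (Fin d) (Fin d) ℝ} {r : ℕ} (hr : 1 ≤ r)
    (hrank : X.rank = r) : 1 ≤ condNumber X r := by
  rw [condNumber, one_le_div (singVal_pos hr hrank)]
  exact singVal_le_one X r

/-- The constant by which the relative deviations are multiplied in the final error, for a
threshold at most `T`. -/
noncomputable def errorFactor (T : ℝ) : ℝ :=
  2 * (2 * T / (√(2 / Real.pi) * foldedNormalQuantile (1 / 2)) + 1 / foldedNormalQuantile (1 / 2))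

lemma errorFactor_pos {T : ℝ} (hT : 0 ≤ T) : 0 < errorFactor T := by
  have hθ := (foldedNormalQuantile_spec (ε := 1 / 2) (by norm_num) (by norm_num)).1
  have := Real.pi_pos
  unfold errorFactor
  positivity

/-- If the spectral matrix is within `η / (κ² √r)` of its mean, and every sample median of the
`|y_i| / N` within `η / κ²` of the threshold `τ`, then the error is `O(η σ_r / κ)`. -/
lemma IsSpectralInit.norm_sub_le_of_deviation {k r : ℕ} {hk : k ≤ d}
    {B : Fin m → Matrix (Fin d) (Fin d) ℝ} {y : Fin m → ℝ} {F : Matrix (Fin d) (Fin k) ℝ}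
    (hF : IsSpectralInit hk B y F) {X U : Matrix (Fin d) (Fin d) ℝ} {N : ℝ} (hX : X.PosSemidef)
    (hr : 1 ≤ r) (hrk : r ≤ k) (hrank : X.rank = r) (hN : 0 < N) (hXU : X = N • U)
    (hNr : N ≤ √r * singVal X 1) {η ψ τ T c : ℝ} (hψ0 : 0 ≤ ψ) (hψ1 : ψ ≤ 1) (hη0 : 0 ≤ η)
    (hητ : η ≤ τ) (hτT : τ ≤ T) (hc : η * errorFactor T ≤ c)
    (hD : ‖spectralMatrix B y - (√(2 / Real.pi) * ψ) • U‖ ≤ η / (condNumber X r ^ 2 * √r))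
    (hξ : ∀ ξ, IsSampleMedian (fun i => |y i|) ξ →
      ξ ∈ Set.Icc ((τ - η / condNumber X r ^ 2) * N) ((τ + η / condNumber X r ^ 2) * N)) :
    ‖F * Fᵀ - (ψ * (τ / foldedNormalQuantile (1 / 2))) • X‖ ≤
      c * singVal X r / condNumber X r := by
  have hκ := one_le_condNumber hr hrank
  have hσ := singVal_pos hr hrank
  have hσ1 : singVal X 1 = condNumber X r * singVal X r := by
    rw [condNumber, div_mul_cancel₀ _ hσ.ne']
  have hθ := (foldedNormalQuantile_spec (ε := 1 / 2) (by norm_num) (by norm_num)).1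
  have hw : 0 < √(2 / Real.pi) := by have := Real.pi_pos; positivity
  have hsr : 0 < √(r : ℝ) := Real.sqrt_pos.2 (by exact_mod_cast hr)
  set κ := condNumber X r
  have hκ0 : 0 < κ := by linarith
  have hκ2 : η / κ ^ 2 ≤ η := div_le_self hη0 (one_le_pow₀ hκ)
  refine (hF.norm_sub_le hX (hrank.trans_le hrk) hN hXU hψ0 hψ1 (η := η / κ ^ 2)
    (by positivity) (hκ2.trans hητ) hD hξ).trans ?_
  have hτ : 0 ≤ τ := hη0.trans hητ
  have hXn := norm_le_singVal_one X
  have h1 : 2 * τ * N / (√(2 / Real.pi) * foldedNormalQuantile (1 / 2)) * (η / (κ ^ 2 * √r)) ≤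
      2 * T * (√r * singVal X 1) / (√(2 / Real.pi) * foldedNormalQuantile (1 / 2)) *
        (η / (κ ^ 2 * √r)) := by
    have := singVal_nonneg X 1
    have hT : 0 ≤ T := hτ.trans hτT
    gcongr
  have h2 : η / κ ^ 2 / foldedNormalQuantile (1 / 2) * ‖X‖ ≤
      η / κ ^ 2 / foldedNormalQuantile (1 / 2) * singVal X 1 := by gcongr
  calc _ ≤ 2 * (2 * T * (√r * singVal X 1) / (√(2 / Real.pi) * foldedNormalQuantile (1 / 2)) *
        (η / (κ ^ 2 * √r)) + η / κ ^ 2 / foldedNormalQuantile (1 / 2) * singVal X 1) := by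
        linarith
    _ = η * errorFactor T * (singVal X r / κ) := by
        rw [errorFactor, hσ1]
        field_simp
    _ ≤ c * (singVal X r / κ) := by gcongr
    _ = _ := by ring

/-- The sample size absorbs the cardinality of the net. For `d = 1` the assumption on the sample
size is void, which costs the factor `exp 4`. -/
lemma pow_mul_exp_le {b κ L : ℝ} {r : ℕ} (hb : 0 < b) (hr : 1 ≤ r) (hκ : 1 ≤ κ) (hL : 1 ≤ L)
    (hm : 16 / b * d * r * κ ^ 4 * L * Real.log d ≤ m) :
    25 ^ d * Real.exp (-(b * m / (κ ^ 4 * r))) ≤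
      Real.exp 4 * Real.exp (-(b / 2 * m / (κ ^ 4 * r))) := by
  have hr0 : (0 : ℝ) < r := by exact_mod_cast hr
  have hκ0 : 0 < κ := by linarith
  have h25 : (25 : ℝ) ≤ Real.exp 4 := by
    have h1 := Real.exp_one_gt_d9
    have h2 : Real.exp 4 = Real.exp 1 ^ 4 := by rw [← Real.exp_nat_mul]; norm_num
    rw [h2]
    calc (25 : ℝ) ≤ 2.7 ^ 4 := by norm_num
      _ ≤ _ := by gcongr; linarith
  have key : 4 * (d : ℝ) ≤ 4 + b / 2 * m / (κ ^ 4 * r) := by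
    have h0 : 0 ≤ b / 2 * m / (κ ^ 4 * r) := by positivity
    rcases Nat.lt_or_ge d 2 with hd | hd
    · have : (d : ℝ) ≤ 1 := by exact_mod_cast Nat.lt_succ_iff.1 hd
      linarith
    · have hlog : 1 / 2 ≤ Real.log d := by
        have h1 := Real.log_two_gt_d9
        have h2 : Real.log 2 ≤ Real.log d :=
          Real.log_le_log (by norm_num) (by exact_mod_cast hd)
        linarith
      have h1 : 4 * (d : ℝ) ≤ b / 2 * m / (κ ^ 4 * r) := by
        rw [le_div_iff₀ (by positivity)]
        have h2 : 1 / 2 ≤ L * Real.log d := by nlinarith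
        have h3 : 16 / b * d * r * κ ^ 4 * (1 / 2) ≤ m := by
          refine le_trans ?_ hm
          rw [mul_assoc _ L]
          gcongr
        calc 4 * (d : ℝ) * (κ ^ 4 * r) = b / 2 * (16 / b * d * r * κ ^ 4 * (1 / 2)) := by
              field_simp
              ring
          _ ≤ _ := by gcongr
      linarith
  calc 25 ^ d * Real.exp (-(b * m / (κ ^ 4 * r)))
      ≤ Real.exp 4 ^ d * Real.exp (-(b * m / (κ ^ 4 * r))) := by gcongr
    _ = Real.exp (4 * d + -(b * m / (κ ^ 4 * r))) := by
        rw [Real.exp_add, ← Real.exp_nat_mul, mul_comm (4 : ℝ)]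
    _ ≤ Real.exp (4 + -(b / 2 * m / (κ ^ 4 * r))) := by
        refine Real.exp_le_exp.2 ?_
        have : b * m / (κ ^ 4 * r) = b / 2 * m / (κ ^ 4 * r) + b / 2 * m / (κ ^ 4 * r) := by ring
        linarith
    _ = _ := by rw [Real.exp_add]

/-- The failure probability at deviation `η / (32 κ² √r)` of the spectral matrix. -/
lemma net_tail_le {η κ L b : ℝ} {r : ℕ} (hη : 0 < η) (hr : 1 ≤ r) (hκ : 1 ≤ κ) (hL : 1 ≤ L)
    (hm : 16 / (η ^ 2 / (2048 * proxy)) * d * r * κ ^ 4 * L * Real.log d ≤ m)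
    (hb : b ≤ η ^ 2 / (2048 * proxy) / 2) :
    25 ^ d * (2 * Real.exp (-(m * (η / (32 * (κ ^ 2 * √r))) ^ 2 / (2 * proxy)))) ≤
      2 * Real.exp 4 * Real.exp (-(b * m / (κ ^ 4 * r))) := by
  have hr0 : (0 : ℝ) < r := by exact_mod_cast hr
  have hκ0 : 0 < κ := by linarith
  have hP := proxy_pos
  have h1 := pow_mul_exp_le (by positivity) hr hκ hL hm
  have e : m * (η / (32 * (κ ^ 2 * √r))) ^ 2 / (2 * proxy) =
      η ^ 2 / (2048 * proxy) * m / (κ ^ 4 * r) := by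
    rw [div_pow, mul_pow, mul_pow, Real.sq_sqrt hr0.le]
    field_simp
    ring
  have h2 : Real.exp (-(η ^ 2 / (2048 * proxy) / 2 * m / (κ ^ 4 * r))) ≤
      Real.exp (-(b * m / (κ ^ 4 * r))) := by
    refine Real.exp_le_exp.2 (neg_le_neg ?_)
    gcongr
  rw [e]
  have h3 := mul_le_mul_of_nonneg_left h2 (Real.exp_pos 4).le
  linarith

/-- The failure probability at deviation `δ / κ²` of the empirical cdf. -/
lemma cdf_tail_le {δ κ b : ℝ} {r : ℕ} (hr : 1 ≤ r) (hκ : 1 ≤ κ)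
    (hb : b ≤ δ ^ 2 / (2 * proxy)) :
    4 * Real.exp (-(m * (δ / κ ^ 2) ^ 2 / (2 * proxy))) ≤
      4 * Real.exp (-(b * m / (κ ^ 4 * r))) := by
  have hr0 : (1 : ℝ) ≤ r := by exact_mod_cast hr
  have hκ0 : 0 < κ := by linarith
  have hP := proxy_pos
  refine mul_le_mul_of_nonneg_left (Real.exp_le_exp.2 (neg_le_neg ?_)) (by norm_num)
  calc b * m / (κ ^ 4 * r) ≤ δ ^ 2 / (2 * proxy) * m / (κ ^ 4 * 1) := by gcongr
    _ = _ := by field_simp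

lemma half_ge_sqrt : √(1 / (2 * Real.pi)) ≤ 1 / 2 := by
  rw [Real.sqrt_le_left (by norm_num), div_le_iff₀ (by have := Real.pi_pos; positivity)]
  have := Real.pi_gt_three
  linarith

lemma three_fifths_le_sqrt : (3 : ℝ) / 5 ≤ √(2 / Real.pi) := by
  refine Real.le_sqrt_of_sq_le ?_
  rw [le_div_iff₀ Real.pi_pos]
  have := Real.pi_lt_four
  linarith

lemma median_mem_Icc_of_card_lt {y : Fin m → ℝ} {lo hi ε : ℝ} (hε : 0 ≤ ε)
    (hlo : ((Finset.univ.filter fun i => |y i| ≤ lo).card : ℝ) < m * (1 / 2 - ε))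
    (hhi : m * (1 / 2 + ε) < ((Finset.univ.filter fun i => |y i| ≤ hi).card : ℝ)) :
    ∀ ξ, IsSampleMedian (fun i => |y i|) ξ → ξ ∈ Set.Icc lo hi := by
  intro ξ hξ
  have h : 0 ≤ (m : ℝ) * ε := by positivity
  refine hξ.mem_Icc ?_ ?_
  · have : (2 * (Finset.univ.filter fun i => |y i| ≤ lo).card : ℝ) < m := by linarith
    exact_mod_cast this
  · have : (m : ℝ) < 2 * (Finset.univ.filter fun i => |y i| ≤ hi).card := by linarith
    exact_mod_cast this

/-- Recovery under random corruption. The number `cstar` is `ψ τ / θ_{1/2}`, where `ψ` is the mean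
attenuation of the shifts and `τ` is the threshold at which the mean cdf of the `|y_i| / N` crosses
`1/2`. -/
theorem exists_norm_sub_le_of_isRC {c₀ : ℝ} (hc₀ : 0 < c₀) {p : ℝ} (hp0 : 0 < p) (hp : p < 1 / 2) :
    ∃ c₄ > (0 : ℝ), ∃ c₅ > (0 : ℝ), ∃ c₆ > (0 : ℝ),
      ∀ (d r k m : ℕ) (_ : 1 ≤ r) (_ : r ≤ k) (hk : k ≤ d)
        (X : Matrix (Fin d) (Fin d) ℝ) (_ : X.PosSemidef) (_ : X.rank = r)
        (_ : c₄ * d * r * condNumber X r ^ 4 *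
          max (Real.log (condNumber X r) + Real.log r) 1 * Real.log d ≤ m)
        (Ω : Type*) (_ : MeasurableSpace Ω) (μ : Measure Ω) (_ : IsProbabilityMeasure μ)
        (A : Ω → Fin m → Matrix (Fin d) (Fin d) ℝ) (s : Ω → Fin m → ℝ)
        (_ : IsIIDGOE μ A) (_ : IsRC μ A s p),
        ∃ cstar ∈ Set.Icc
            (√(1 / (2 * Real.pi)) * (foldedNormalQuantile ((1 / 2 - p) / 3) /
              foldedNormalQuantile (1 / 2)))
            (√(2 / Real.pi) * (foldedNormalQuantile (1 - (1 / 2 - p) / 3) /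
              foldedNormalQuantile (1 / 2))),
          HoldsWithProb μ
            (1 - c₅ * Real.exp (-(c₆ * m / (condNumber X r ^ 4 * r))))
            (fun ω => ∀ F₀ : Matrix (Fin d) (Fin k) ℝ,
              IsSpectralInit hk (A ω) (observations (A ω) X (s ω)) F₀ →
              ‖F₀ * F₀ᵀ - cstar • X‖ ≤ c₀ * singVal X r / condNumber X r) := by
  have hP := proxy_pos
  have hθ := (foldedNormalQuantile_spec (ε := 1 / 2) (by norm_num) (by norm_num)).1
  have hL0 := (foldedNormalQuantile_spec (ε := (1 / 2 - p) / 3) (by linarith) (by linarith)).1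
  have hT0 := (foldedNormalQuantile_spec (ε := 1 - (1 / 2 - p) / 3) (by linarith)
    (by linarith)).1
  have hLT := foldedNormalQuantile_mono (a := (1 / 2 - p) / 3) (b := 1 - (1 / 2 - p) / 3)
    (by linarith) (by linarith) (by linarith)
  have hs1 := half_ge_sqrt
  have hs2 := three_fifths_le_sqrt
  set θ := foldedNormalQuantile (1 / 2)
  set L := foldedNormalQuantile ((1 / 2 - p) / 3)
  set T := foldedNormalQuantile (1 - (1 / 2 - p) / 3)
  have hK := errorFactor_pos hT0.le
  set φ := gaussianPDFReal 0 1 (T + 1) with hφ_def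
  have hφ : 0 < φ := gaussianPDFReal_pos 0 1 _ one_ne_zero
  obtain ⟨η, hη0, hη1, hηL, hηc⟩ : ∃ η > 0, η ≤ 1 ∧ η ≤ L ∧ η * errorFactor T ≤ c₀ := by
    refine ⟨min (min 1 L) (c₀ / errorFactor T), by positivity,
      (min_le_left _ _).trans (min_le_left _ _), (min_le_left _ _).trans (min_le_right _ _), ?_⟩
    rw [← le_div_iff₀ hK]
    exact min_le_right _ _
  -- moving by `η / κ²` away from the threshold changes the mean cdf by `2 δ / κ²`: half of it is
  -- left to the fluctuations
  set δ := (1 - p) * φ * η / 2 with hδ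
  have hδ0 : 0 < δ := by
    have : 0 < 1 - p := by linarith
    positivity
  refine ⟨16 / (η ^ 2 / (2048 * proxy)), by positivity, 2 * Real.exp 4 + 4, by positivity,
    min (η ^ 2 / (2048 * proxy) / 2) (δ ^ 2 / (2 * proxy)), by positivity, ?_⟩
  intro d r k m hr hrk hk X hX hrank hm Ω _ μ _ A s hA hs
  have hκ := one_le_condNumber hr hrank
  obtain ⟨N, U, hN, hUs, hU1, hXU, hNr⟩ := exists_unit_direction hX hr hrank
  set κ := condNumber X r with hκ_def
  have hκ0 : 0 < κ := by linarith
  rcases Nat.eq_zero_or_pos m with rfl | hm0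
  · -- without samples the claimed probability is nonpositive, and any admissible number will do
    refine ⟨_, Set.left_mem_Icc.2 (mul_le_mul (by linarith)
      (div_le_div_of_nonneg_right hLT hθ.le) (by positivity) (by positivity)),
      HoldsWithProb.of_nonpos ?_⟩
    have := Real.exp_pos 4
    simp
    linarith
  have hmod := hs.isIndepModel hA
  have hβ : ∀ i, (μ.map fun ω => s ω i).real {0} = 1 - p := by
    intro i
    have hmeas : MeasurableSet {ω | s ω i ≠ 0} :=
      (measurableSet_eq_fun (hs.measurable i) measurable_const).compl
    rw [measureReal_def, Measure.map_apply (hs.measurable i) (measurableSet_singleton _),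
      ← measureReal_def, show (fun ω => s ω i) ⁻¹' {0} = {ω | s ω i ≠ 0}ᶜ by ext; simp,
      measureReal_compl hmeas, probReal_univ, measureReal_def, hs.prob_ne_zero,
      ENNReal.toReal_ofReal hp0.le]
  have hψ1 := hmod.meanAttenuation_le_one (N := N) hm0
  have hψ := hmod.le_meanAttenuation (N := N) hm0 fun i => (hβ i).ge
  obtain ⟨τ, hLτ, hτT, hψτ, hlow, hup⟩ := exists_threshold hp0 hp hψ
    (hmod.meanAttenuation_mul_cdf_le hN) (hmod.meanCdf_le hN hm0 hβ)
  set ψ := meanAttenuation μ s N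
  refine ⟨ψ * (τ / θ), ⟨?_, ?_⟩, ?_⟩
  · have : √(1 / (2 * Real.pi)) ≤ ψ := by linarith
    gcongr
    linarith [Real.sqrt_nonneg (1 / (2 * Real.pi))]
  · rw [mul_div_assoc', mul_div_assoc']
    refine div_le_div_of_nonneg_right (hψτ.trans ?_) hθ.le
    gcongr
  · have hη' : η / κ ^ 2 ≤ η := div_le_self hη0.le (one_le_pow₀ hκ)
    obtain ⟨g1, g2⟩ := hmod.meanCdf_gap hN hm0 (by linarith) (fun i => (hβ i).ge)
      (η := η / κ ^ 2) (by positivity) (by linarith) (by linarith) hτT hlow hup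
    have e : (1 - p) * gaussianPDFReal 0 1 (T + 1) * (η / κ ^ 2) = 2 * (δ / κ ^ 2) := by
      rw [hδ, hφ_def]
      ring
    rw [e] at g1 g2
    have key := hmod.measureReal_not_good_le hUs hU1 hN hm0
      (a := η / (32 * (κ ^ 2 * √r))) (by positivity) (by positivity) g1 g2
    refine HoldsWithProb.of_measureReal_le (δ := (2 * Real.exp 4 + 4) * Real.exp
      (-(min (η ^ 2 / (2048 * proxy) / 2) (δ ^ 2 / (2 * proxy)) * m / (κ ^ 4 * r)))) ?_ le_rfl
    have t1 := net_tail_le hη0 hr hκ (le_max_right _ _) hm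
      (min_le_left _ (δ ^ 2 / (2 * proxy)))
    have t2 := cdf_tail_le (m := m) hr hκ (min_le_right (η ^ 2 / (2048 * proxy) / 2)
      (δ ^ 2 / (2 * proxy)))
    rw [add_mul]
    refine le_trans (measureReal_mono ?_ (measure_ne_top _ _)) (key.trans (add_le_add t1 t2))
    intro ω hω hgood
    refine hω ?_
    obtain ⟨e1, e2, e3⟩ := hgood
    intro F hF
    rw [observations_eq hXU] at hF
    refine hF.norm_sub_le_of_deviation hX hr hrk hrank hN hXU hNr (by linarith) hψ1 hη0.le
      (hηL.trans hLτ) hτT hηc (e1.trans ?_) (median_mem_Icc_of_card_lt (by positivity) e2 e3)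
    rw [← hκ_def]
    have : 0 ≤ η / (κ ^ 2 * √r) := by positivity
    calc 4 * (η / (32 * (κ ^ 2 * √r))) = 1 / 8 * (η / (κ ^ 2 * √r)) := by ring
      _ ≤ _ := by linarith

/-- Changing the values with index in `T` changes an empirical count by at most `|T|`. -/
lemma card_filter_le_add {y y' : Fin m → ℝ} {T : Finset (Fin m)} (hT : ∀ i ∉ T, y i = y' i)
    (a : ℝ) :
    (Finset.univ.filter fun i => |y i| ≤ a).card ≤
      (Finset.univ.filter fun i => |y' i| ≤ a).card + T.card := by
  classical
  refine (Finset.card_le_card fun i hi => ?_).trans (Finset.card_union_le _ T)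
  rw [Finset.mem_union, Finset.mem_filter]
  by_cases h : i ∈ T
  · exact Or.inr h
  · exact Or.inl ⟨Finset.mem_univ _, by simpa [hT i h] using hi⟩

/-- Recovery under arbitrary corruption: the uncorrupted sample is good, and the corruption moves
the spectral matrix and the empirical counts by `O(p)` only. -/
theorem norm_sub_le_of_isAC {c₀ : ℝ} (hc₀ : 0 < c₀) :
    ∃ c₀' > (0 : ℝ), ∃ c₁ > (0 : ℝ), ∃ c₂ > (0 : ℝ), ∃ c₃ > (0 : ℝ),
      ∀ (d r k m : ℕ) (_ : 1 ≤ r) (_ : r ≤ k) (hk : k ≤ d)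
        (X : Matrix (Fin d) (Fin d) ℝ) (_ : X.PosSemidef) (_ : X.rank = r)
        (p : ℝ) (_ : 0 ≤ p) (_ : p ≤ c₀' / (condNumber X r ^ 2 * √(r : ℝ)))
        (_ : c₁ * d * r * condNumber X r ^ 4 *
          max (Real.log (condNumber X r) + Real.log r) 1 * Real.log d ≤ m)
        (Ω : Type*) (_ : MeasurableSpace Ω) (μ : Measure Ω) (_ : IsProbabilityMeasure μ)
        (A : Ω → Fin m → Matrix (Fin d) (Fin d) ℝ) (s : Ω → Fin m → ℝ)
        (_ : IsIIDGOE μ A) (_ : IsAC μ A s p),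
        HoldsWithProb μ
          (1 - c₂ * Real.exp (-(c₃ * m / (condNumber X r ^ 4 * r))))
          (fun ω => ∀ F₀ : Matrix (Fin d) (Fin k) ℝ,
            IsSpectralInit hk (A ω) (observations (A ω) X (s ω)) F₀ →
            ‖F₀ * F₀ᵀ - X‖ ≤ c₀ * singVal X r / condNumber X r) := by
  have hP := proxy_pos
  obtain ⟨hθ, hθ'⟩ := foldedNormalQuantile_spec (ε := 1 / 2) (by norm_num) (by norm_num)
  set θ := foldedNormalQuantile (1 / 2) with hθ_def
  have hK := errorFactor_pos hθ.le
  set φ := gaussianPDFReal 0 1 (θ + 1) with hφ_def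
  have hφ : 0 < φ := gaussianPDFReal_pos 0 1 _ one_ne_zero
  obtain ⟨η, hη0, hη1, hηθ, hηc⟩ : ∃ η > 0, η ≤ 1 ∧ η ≤ θ ∧ η * errorFactor θ ≤ c₀ := by
    refine ⟨min (min 1 θ) (c₀ / errorFactor θ), by positivity,
      (min_le_left _ _).trans (min_le_left _ _), (min_le_left _ _).trans (min_le_right _ _), ?_⟩
    rw [← le_div_iff₀ hK]
    exact min_le_right _ _
  -- moving by `η / κ²` away from the threshold changes the cdf by `2 δ / κ²`: half of it is left to
  -- the fluctuations, the other half to the corruption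
  set δ := φ * η / 2 with hδ
  have hδ0 : 0 < δ := by positivity
  refine ⟨min (η / 128) δ, by positivity, 16 / (η ^ 2 / (2048 * proxy)), by positivity,
    4 * Real.exp 4 + 4, by positivity,
    min (η ^ 2 / (2048 * proxy) / 2) (δ ^ 2 / (2 * proxy)), by positivity, ?_⟩
  intro d r k m hr hrk hk X hX hrank p hp0 hp hm Ω _ μ _ A s hA hs
  have hκ := one_le_condNumber hr hrank
  obtain ⟨N, U, hN, hUs, hU1, hXU, hNr⟩ := exists_unit_direction hX hr hrank
  set κ := condNumber X r with hκ_def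
  have hκ0 : 0 < κ := by linarith
  rcases Nat.eq_zero_or_pos m with rfl | hm0
  · -- without samples the claimed probability is nonpositive
    refine HoldsWithProb.of_nonpos ?_
    have := Real.exp_pos 4
    simp
    linarith
  have hm' : (0 : ℝ) < m := by exact_mod_cast hm0
  have hr1 : (1 : ℝ) ≤ √r := Real.one_le_sqrt.2 (by exact_mod_cast hr)
  have hp1 : p ≤ 1 / 128 * (η / (κ ^ 2 * √r)) := hp.trans <| by
    rw [mul_div_assoc', one_div_mul_eq_div]
    gcongr
    exact min_le_left _ _
  have hp2 : p ≤ δ / κ ^ 2 := hp.trans <| by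
    refine div_le_div₀ hδ0.le (min_le_right _ _) (by positivity) ?_
    exact le_mul_of_one_le_right (by positivity) hr1
  have hmod := hA.isIndepModel_zero
  have hβ : ∀ i : Fin m, (μ.map fun ω => (fun _ _ => 0 : Ω → Fin m → ℝ) ω i).real {0} = 1 := by
    intro i
    simp [Measure.map_const, measureReal_def]
  have hψ : meanAttenuation μ (fun _ _ => 0 : Ω → Fin m → ℝ) N = 1 :=
    le_antisymm (hmod.meanAttenuation_le_one hm0)
      (hmod.le_meanAttenuation hm0 fun i => (hβ i).ge)
  have hF1 : ∀ t, cdf foldedNormal t ≤ meanCdf μ (fun _ _ => 0 : Ω → Fin m → ℝ) N t := by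
    intro t
    have := hmod.meanAttenuation_mul_cdf_le hN t
    rwa [hψ, one_mul] at this
  have hF2 : ∀ t, meanCdf μ (fun _ _ => 0 : Ω → Fin m → ℝ) N t ≤ cdf foldedNormal t := by
    intro t
    have := hmod.meanCdf_le hN hm0 (p := 0) (by simpa using hβ) t
    simpa using this
  have hη' : η / κ ^ 2 ≤ η := div_le_self hη0.le (one_le_pow₀ hκ)
  obtain ⟨g1, g2⟩ := hmod.meanCdf_gap hN hm0 zero_le_one (fun i => (hβ i).ge)
    (η := η / κ ^ 2) (τ := θ) (by positivity) (by linarith) (by linarith) le_rfl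
    (fun t ht0 ht => (hF2 t).trans_lt
      (hθ' ▸ strictMonoOn_cdf_foldedNormal (Set.mem_Ici.2 ht0) (Set.mem_Ici.2 hθ.le) ht))
    (fun t ht => ⟨θ, hθ.le, ht, hθ'.ge.trans (hF1 θ)⟩)
  have e : 1 * gaussianPDFReal 0 1 (θ + 1) * (η / κ ^ 2) = 2 * (δ / κ ^ 2) := by
    rw [hδ, hφ_def]
    ring
  rw [e] at g1 g2
  have key := hmod.measureReal_not_good_le hUs hU1 hN hm0
    (a := η / (32 * (κ ^ 2 * √r))) (by positivity) (by positivity) g1 g2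
  have key2 := hs.measureReal_norm_sub_gt_le hA hp0 hm0
    (t := η / (32 * (κ ^ 2 * √r))) (by positivity)
  refine HoldsWithProb.of_measureReal_le (δ := (4 * Real.exp 4 + 4) * Real.exp
    (-(min (η ^ 2 / (2048 * proxy) / 2) (δ ^ 2 / (2 * proxy)) * m / (κ ^ 4 * r)))) ?_ le_rfl
  have t1 := net_tail_le hη0 hr hκ (le_max_right _ _) hm
    (min_le_left _ (δ ^ 2 / (2 * proxy)))
  have t2 := cdf_tail_le (m := m) hr hκ (min_le_right (η ^ 2 / (2048 * proxy) / 2)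
    (δ ^ 2 / (2 * proxy)))
  refine le_trans (b := μ.real (_ ∪ _)) ?_ ((measureReal_union_le _ _).trans
    ((add_le_add key key2).trans (by linarith)))
  refine ENNReal.toReal_mono (measure_ne_top _ _) (measure_mono_ae ?_)
  filter_upwards [hs.ae_ncard_le hp0] with ω hω hbad
  by_contra hcon
  refine hbad ?_
  obtain ⟨hgood, hclose⟩ := not_or.1 hcon
  obtain ⟨e1, e2, e3⟩ := not_not.1 hgood
  intro F hF
  rw [observations_eq hXU] at hF
  have h0 : ∀ i, s ω i = 0 → N * frobInner (A ω i) U + s ω i = N * frobInner (A ω i) U + 0 :=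
    fun i hi => by rw [hi]
  have hclose' := not_lt.1 fun hlt => hclose ⟨_, _, h0, hlt⟩
  rw [hψ, mul_one] at e1
  set y : Fin m → ℝ := fun i => N * frobInner (A ω i) U + s ω i with hy
  set y' : Fin m → ℝ := fun i => N * frobInner (A ω i) U + 0 with hy'
  have hcard : ∀ a : ℝ, ((Finset.univ.filter fun i => |y i| ≤ a).card : ℝ) ≤
      (Finset.univ.filter fun i => |y' i| ≤ a).card + δ / κ ^ 2 * m ∧
      ((Finset.univ.filter fun i => |y' i| ≤ a).card : ℝ) ≤
      (Finset.univ.filter fun i => |y i| ≤ a).card + δ / κ ^ 2 * m := by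
    classical
    intro a
    set T := (Function.support (s ω)).toFinset with hT
    have hTcard : (T.card : ℝ) ≤ δ / κ ^ 2 * m := by
      rw [hT, ← Set.ncard_eq_toFinset_card']
      exact hω.trans (by gcongr)
    have hTy : ∀ i ∉ T, y i = y' i := fun i hi => h0 i (by simpa [hT] using hi)
    have c1 : ((Finset.univ.filter fun i => |y i| ≤ a).card : ℝ) ≤
      (Finset.univ.filter fun i => |y' i| ≤ a).card + T.card := by
      exact_mod_cast card_filter_le_add hTy a
    have c2 : ((Finset.univ.filter fun i => |y' i| ≤ a).card : ℝ) ≤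
      (Finset.univ.filter fun i => |y i| ≤ a).card + T.card := by
      exact_mod_cast card_filter_le_add (fun i hi => (hTy i hi).symm) a
    constructor <;> linarith
  -- the parts of the budget `η / (κ² √r)` are `4 / 32` for the fluctuations without corruption,
  -- `32 / 128` for the term `32 p` and `8 / 32` for the fluctuations of the corrupted part
  have hD : ‖spectralMatrix (A ω) y - (√(2 / Real.pi) * 1) • U‖ ≤ η / (κ ^ 2 * √r) := by
    have h1 := norm_sub_le_norm_sub_add_norm_sub (spectralMatrix (A ω) y)
      (spectralMatrix (A ω) y') ((√(2 / Real.pi) * 1) • U)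
    rw [mul_one] at h1 ⊢
    have h2 : η / (32 * (κ ^ 2 * √r)) = 1 / 32 * (η / (κ ^ 2 * √r)) := by ring
    rw [h2] at hclose' e1
    have h3 : 0 ≤ η / (κ ^ 2 * √r) := by positivity
    linarith
  have hfin := hF.norm_sub_le_of_deviation hX hr hrk hrank hN hXU hNr zero_le_one le_rfl
    hη0.le hηθ le_rfl hηc hD (median_mem_Icc_of_card_lt le_rfl
      (by linarith [(hcard ((θ - η / κ ^ 2) * N)).1, e2])
      (by linarith [(hcard ((θ + η / κ ^ 2) * N)).2, e3]))
  rwa [one_mul, ← hθ_def, div_self hθ.ne', one_smul] at hfin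

end

end RobustSensing

theorem mainTheorem5 (c₀ : ℝ) (hc₀ : 0 < c₀) (hc₀' : c₀ < 1 / 10) :
    -- arbitrary corruption
    (∃ c₀' > (0 : ℝ), ∃ c₁ > (0 : ℝ), ∃ c₂ > (0 : ℝ), ∃ c₃ > (0 : ℝ),
      ∀ (d r k m : ℕ) (_ : 1 ≤ r) (_ : r ≤ k) (hk : k ≤ d)
        (X : Matrix (Fin d) (Fin d) ℝ) (_ : X.PosSemidef) (_ : X.rank = r)
        (p : ℝ) (_ : 0 ≤ p) (_ : p ≤ c₀' / (RobustSensing.condNumber X r ^ 2 * √(r : ℝ)))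
        (_ : c₁ * d * r * RobustSensing.condNumber X r ^ 4 *
          max (Real.log (RobustSensing.condNumber X r) + Real.log r) 1 * Real.log d ≤ m)
        (Ω : Type*) (_ : MeasurableSpace Ω) (μ : MeasureTheory.Measure Ω)
        (_ : MeasureTheory.IsProbabilityMeasure μ)
        (A : Ω → Fin m → Matrix (Fin d) (Fin d) ℝ) (s : Ω → Fin m → ℝ)
        (_ : RobustSensing.IsIIDGOE μ A) (_ : RobustSensing.IsAC μ A s p),
        RobustSensing.HoldsWithProb μ
          (1 - c₂ * Real.exp (-(c₃ * m / (RobustSensing.condNumber X r ^ 4 * r)))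
            - Real.exp (-(p * m + d)))
          (fun ω => ∀ F₀ : Matrix (Fin d) (Fin k) ℝ,
            RobustSensing.IsSpectralInit hk (A ω)
              (RobustSensing.observations (A ω) X (s ω)) F₀ →
            ‖F₀ * F₀ᵀ - X‖ ≤
              c₀ * RobustSensing.singVal X r / RobustSensing.condNumber X r)) ∧
    -- random corruption
    (∀ p : ℝ, 0 < p → p < 1 / 2 →
      ∃ c₄ > (0 : ℝ), ∃ c₅ > (0 : ℝ), ∃ c₆ > (0 : ℝ),
      ∀ (d r k m : ℕ) (_ : 1 ≤ r) (_ : r ≤ k) (hk : k ≤ d)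
        (X : Matrix (Fin d) (Fin d) ℝ) (_ : X.PosSemidef) (_ : X.rank = r)
        (_ : c₄ * d * r * RobustSensing.condNumber X r ^ 4 *
          max (Real.log (RobustSensing.condNumber X r) + Real.log r) 1 * Real.log d ≤ m)
        (Ω : Type*) (_ : MeasurableSpace Ω) (μ : MeasureTheory.Measure Ω)
        (_ : MeasureTheory.IsProbabilityMeasure μ)
        (A : Ω → Fin m → Matrix (Fin d) (Fin d) ℝ) (s : Ω → Fin m → ℝ)
        (_ : RobustSensing.IsIIDGOE μ A) (_ : RobustSensing.IsRC μ A s p),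
        ∃ cstar ∈ Set.Icc
            (√(1 / (2 * Real.pi)) * (RobustSensing.foldedNormalQuantile ((1 / 2 - p) / 3) /
              RobustSensing.foldedNormalQuantile (1 / 2)))
            (√(2 / Real.pi) * (RobustSensing.foldedNormalQuantile (1 - (1 / 2 - p) / 3) /
              RobustSensing.foldedNormalQuantile (1 / 2))),
          RobustSensing.HoldsWithProb μ
            (1 - c₅ * Real.exp (-(c₆ * m / (RobustSensing.condNumber X r ^ 4 * r))))
            (fun ω => ∀ F₀ : Matrix (Fin d) (Fin k) ℝ,
              RobustSensing.IsSpectralInit hk (A ω)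
                (RobustSensing.observations (A ω) X (s ω)) F₀ →
              ‖F₀ * F₀ᵀ - cstar • X‖ ≤
                c₀ * RobustSensing.singVal X r / RobustSensing.condNumber X r)) := by
  constructor
  · obtain ⟨c₀', h0, c₁, h1, c₂, h2, c₃, h3, H⟩ := RobustSensing.norm_sub_le_of_isAC hc₀
    refine ⟨c₀', h0, c₁, h1, c₂, h2, c₃, h3, ?_⟩
    intro d r k m hr hrk hk X hX hrank p hp0 hp hm Ω hΩ μ hμ A s hA hs
    obtain ⟨E, hE, hq, hP⟩ := H d r k m hr hrk hk X hX hrank p hp0 hp hm Ω hΩ μ hμ A s hA hs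
    exact ⟨E, hE, (sub_le_self _ (Real.exp_pos _).le).trans hq, hP⟩
  · intro p hp0 hp
    exact RobustSensing.exists_norm_sub_le_of_isRC hc₀ hp0 hp
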